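/- Let $S$ be a finite non-empty set and let $r:S\times S\to[0,\infty)$, with $r(x,x)=0$, be the jump rates of an irreducible continuous-time Markov chain on $S$. Let $(d_N)_{N\ge1}$ be positive numbers with $d_N\to0$ and $d_N\log N\to0$. The inclusion process with $N$ particles is the continuous-time Markov chain on $\mathcal H_N=\{\eta\in\mathbb N^S:\sum_{x\in S}\eta_x=N\}$ with generator $$(\mathcal L_NF)(\eta)=\sum_{x,y\in S}\eta_x(d_N+\eta_y)\,r(x,y)\,\{F(\sigma^{x,y}\eta)-F(\eta)\},$$ where $\sigma^{x,y}\eta$ is obtained from $\eta$ by moving one particle from $x$ to $y$ (and $\sigma^{x,y}\eta=\eta$ if $\eta_x=0$). Let $\mu_N$ be its unique invariant probability measure, let $\xi_N^x$ be the configuration with all $N$ particles at $x$, and put $$S_\star=\{x\in S:\limsup_{N\to\infty}\mu_N(\xi_N^x)>0\}.$$ Suppose that condensation occurs, that is, $\lim_{N\to\infty}\mu_N(\{\xi_N^x:x\in S\})=1$. Let $b(x,y)=\max\{r(x,y)-r(y,x),0\}$, and let $S_0\subseteq S$ be the set of recurrent states (including absorbing states) of the Markov chain on $S$ with jump rates $b$.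 A Markov chain on a set is called irreducible if each of its states can be reached from every other one (so a chain with a single state is irreducible). 1. Suppose that the chain with rates $b$ restricted to $S_0$ is irreducible. Then the Markov chain on $S_\star$ with rates $b(x,y)$, $x,y\in S_\star$, is irreducible, it has a unique invariant probability measure $\nu$, and $\lim_{N\to\infty}\mu_N(\xi_N^x)=\nu(x)$ for all $x\in S_\star$. 2. Suppose that $r(x,y)=r(y,x)$ for all $x,y\in S_0$, that the Markov chain on $S_0$ with rates $r(x,y)$, $x,y\in S_0$, is irreducible, and that $S_0$ is attracting, that is, $r(x,y)<r(y,x)$ for all $x\in S_0$ and $y\in S\setminus S_0$ with $r(x,y)+r(y,x)>0$. Then the Markov chain on $S_\star$ with rates $r(x,y)$, $x,y\in S_\star$, is irreducible, it has a unique invariant probability measure $\nu$, and $\lim_{N\to\infty}\mu_N(\xi_N^x)=\nu(x)$ for all $x\in S_\star$. -/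

import Mathlib

open Filter Topology

noncomputable section

namespace InclusionProcess

/-! Continuous-time Markov chains on a finite set `V`, given by jump rates `q x y` (`x ≠ y`). -/

section Chains

variable {V : Type*}

/-- The generator of the chain with jump rates `q`. -/
def jumpGenerator [Fintype V] (q : V → V → ℝ) (F : V → ℝ) (x : V) : ℝ :=
  ∑ y, q x y * (F y - F x)

/-- `π` is an invariant (probability) measure of the chain with generator `G`. -/
structure IsInvariantMeasure [Fintype V] (G : (V → ℝ) → V → ℝ) (π : V → ℝ) : Prop where
  nonneg : ∀ x, 0 ≤ π x
  sum_eq_one : ∑ x, π x = 1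
  stationary : ∀ F : V → ℝ, ∑ x, π x * G F x = 0

/-- `y` can be reached from `x` by jumps of positive rate (`x` is reached from itself). -/
def Reaches (q : V → V → ℝ) (x y : V) : Prop :=
  Relation.ReflTransGen (fun u v => 0 < q u v) x y

/-- Every state can be reached from every other state. -/
def IsIrreducibleChain (q : V → V → ℝ) : Prop :=
  ∀ x y, Reaches q x y

/-- The rates of the chain restricted to `A`: jumps out of `A` are suppressed. -/
def restrictRate (q : V → V → ℝ) (A : Finset V) : A → A → ℝ :=
  fun x y => q x y

open Classical in
/-- Transition probabilities of the embedded jump chain: `q x y / ∑ z, q x z` when the holding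
rate is positive; an absorbing state stays where it is. -/
def jumpProb [Fintype V] (q : V → V → ℝ) (x y : V) : ℝ :=
  if ∑ z, q x z = 0 then (if x = y then 1 else 0) else q x y / ∑ z, q x z

open Classical in
/-- `firstPassage q x n y` is the probability that the embedded jump chain started at `y` visits
`x`, for the first time at a positive time, at time `n + 1`. -/
def firstPassage [Fintype V] (q : V → V → ℝ) (x : V) : ℕ → V → ℝ
  | 0, y => jumpProb q y x
  | n + 1, y => ∑ z, if z = x then 0 else jumpProb q y z * firstPassage q x n z

/-- A state is recurrent when the chain returns to it with probability one.  Absorbing states are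
recurrent. -/
def IsRecurrent [Fintype V] (q : V → V → ℝ) (x : V) : Prop :=
  HasSum (fun n => firstPassage q x n x) 1

end Chains

/-! The inclusion process on a finite set `S`. -/

section Model

variable {S : Type*} [Fintype S] [DecidableEq S]

/-- The configurations of `N` particles on `S`. -/
abbrev Config (S : Type*) [Fintype S] (N : ℕ) : Type _ := {η : S → ℕ // ∑ x, η x = N}

instance configFintype (N : ℕ) : Fintype (Config S N) :=
  Fintype.subtype (Finset.piAntidiag Finset.univ N) (by simp)

/-- `move η x y` is `σ^{x,y} η`: one particle is sent from `x` to `y`, if there is one at `x`. -/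
def move {N : ℕ} (η : Config S N) (x y : S) : Config S N :=
  if h : η.1 x = 0 ∨ x = y then η else
    ⟨fun z => if z = x then η.1 x - 1 else if z = y then η.1 y + 1 else η.1 z, by
      obtain ⟨hx, hxy⟩ := not_or.1 h
      have key : ∀ z, ((if z = x then η.1 x - 1 else if z = y then η.1 y + 1 else η.1 z)
          + (if z = x then 1 else 0)) = η.1 z + (if z = y then 1 else 0) := by
        intro z
        by_cases h1 : z = x
        · subst h1; simp [hxy]; omega
        · by_cases h2 : z = y
          · subst h2; simp [h1]
          · simp [h1, h2]
      have h3 := Finset.sum_congr (rfl : (Finset.univ : Finset S) = _) (fun z _ => key z)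
      rw [Finset.sum_add_distrib, Finset.sum_add_distrib, η.2] at h3
      simpa using h3⟩

/-- The generator of the inclusion process with `N` particles, diffusion parameter `δ` and
underlying jump rates `r`. -/
def inclusionGenerator (r : S → S → ℝ) (δ : ℝ) (N : ℕ) (F : Config S N → ℝ)
    (η : Config S N) : ℝ :=
  ∑ x, ∑ y, (η.1 x : ℝ) * (δ + (η.1 y : ℝ)) * r x y * (F (move η x y) - F η)

/-- The invariant measure of the inclusion process.  It exists and is unique as soon as `0 < δ` and
`r` is nonnegative, zero on the diagonal and irreducible; see `isInvariant_inclusionMeasure` and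
`inclusionMeasure_unique`. -/
def inclusionMeasure (r : S → S → ℝ) (δ : ℝ) (N : ℕ) : Config S N → ℝ :=
  Classical.epsilon (IsInvariantMeasure (inclusionGenerator r δ N))

/-- The configuration with all `N` particles at `x`. -/
def condensed (N : ℕ) (x : S) : Config S N :=
  ⟨fun y => if y = x then N else 0, by simp⟩

/-- The set of all configurations with all `N` particles at one site. -/
def condensedSet (S : Type*) [Fintype S] [DecidableEq S] (N : ℕ) : Finset (Config S N) :=
  Finset.univ.image (condensed N)

/-- Condensation: the invariant measures concentrate on the condensed configurations. -/
def Condensation (r : S → S → ℝ) (d : ℕ → ℝ) : Prop :=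
  Tendsto (fun N => ∑ η ∈ condensedSet S N, inclusionMeasure r (d N) N η) atTop (𝓝 1)

open Classical in
/-- The maximal condensing set. -/
def condensingSet (r : S → S → ℝ) (d : ℕ → ℝ) : Finset S :=
  Finset.univ.filter fun x =>
    0 < limsup (fun N => inclusionMeasure r (d N) N (condensed N x)) atTop

/-- The rates `(r(x,y) - r(y,x))_+`. -/
def asymRate (r : S → S → ℝ) (x y : S) : ℝ := max (r x y - r y x) 0

open Classical in
/-- The set of recurrent states of the chain with rates `(r(x,y) - r(y,x))_+`. -/
def recurrentSet (r : S → S → ℝ) : Finset S :=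
  Finset.univ.filter fun x => IsRecurrent (asymRate r) x

/-- Attracting sets. -/
def IsAttracting (r : S → S → ℝ) (A : Finset S) : Prop :=
  ∀ x ∈ A, ∀ y ∉ A, 0 < r x y + r y x → r x y < r y x

end Model

/-! Existence and uniqueness of invariant measures, and recurrence of finite chains. -/

section Facts

variable {V : Type*} [Fintype V]

/-- The total jump rate out of a state balances the flow into it. -/
def Balanced (q : V → V → ℝ) (v : V → ℝ) : Prop :=
  ∀ y, ∑ x, v x * q x y = v y * ∑ x, q y x

theorem sum_jumpGenerator (q : V → V → ℝ) (v F : V → ℝ) :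
    ∑ x, v x * jumpGenerator q F x = ∑ y, F y * (∑ x, v x * q x y - v y * ∑ x, q y x) := by
  have h1 : ∑ x, v x * jumpGenerator q F x
      = ∑ x, ∑ y, F y * (v x * q x y) - ∑ x, F x * (v x * ∑ y, q x y) := by
    rw [← Finset.sum_sub_distrib]
    refine Finset.sum_congr rfl fun x _ => ?_
    simp only [jumpGenerator, Finset.mul_sum]
    rw [← Finset.sum_sub_distrib]
    exact Finset.sum_congr rfl fun y _ => by ring
  rw [h1, Finset.sum_comm, ← Finset.sum_sub_distrib]
  refine Finset.sum_congr rfl fun y _ => ?_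
  rw [mul_sub, ← Finset.mul_sum]

theorem stationary_iff_balanced (q : V → V → ℝ) (v : V → ℝ) :
    (∀ F : V → ℝ, ∑ x, v x * jumpGenerator q F x = 0) ↔ Balanced q v := by
  classical
  constructor
  · intro h y
    have := h (fun z => if z = y then 1 else 0)
    rw [sum_jumpGenerator] at this
    simp only [ite_mul, one_mul, zero_mul, Finset.sum_ite_eq', Finset.mem_univ, if_true] at this
    linarith
  · intro h F
    rw [sum_jumpGenerator]
    exact Finset.sum_eq_zero fun y _ => by rw [h y]; simp

theorem Balanced.abs {q : V → V → ℝ} (hq : ∀ x y, 0 ≤ q x y) {v : V → ℝ} (hv : Balanced q v) :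
    Balanced q (fun x => |v x|) := by
  have hle : ∀ y ∈ (Finset.univ : Finset V), |v y| * ∑ x, q y x ≤ ∑ x, |v x| * q x y := by
    intro y _
    have h0 : 0 ≤ ∑ x, q y x := Finset.sum_nonneg fun x _ => hq y x
    calc |v y| * ∑ x, q y x = |∑ x, v x * q x y| := by rw [hv y, abs_mul, abs_of_nonneg h0]
      _ ≤ ∑ x, |v x * q x y| := Finset.abs_sum_le_sum_abs _ _
      _ = ∑ x, |v x| * q x y :=
        Finset.sum_congr rfl fun x _ => by rw [abs_mul, abs_of_nonneg (hq x y)]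
  have hsum : ∑ y, |v y| * ∑ x, q y x = ∑ y, ∑ x, |v x| * q x y := by
    rw [Finset.sum_comm]
    exact Finset.sum_congr rfl fun y _ => by rw [Finset.mul_sum]
  have := (Finset.sum_eq_sum_iff_of_le hle).1 hsum
  exact fun y => (this y (Finset.mem_univ y)).symm

theorem exists_isInvariant [Nonempty V] {q : V → V → ℝ} (hq : ∀ x y, 0 ≤ q x y) :
    ∃ π, IsInvariantMeasure (jumpGenerator q) π := by
  classical
  let Q : Matrix V V ℝ := fun x y => q x y - if x = y then ∑ z, q x z else 0
  have h1 : Q.mulVec (fun _ => 1) = 0 := by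
    funext x
    simp [Q, Matrix.mulVec, dotProduct]
  have hdet : Q.det = 0 := by
    refine Matrix.exists_mulVec_eq_zero_iff.1 ⟨fun _ => 1, ?_, h1⟩
    intro h
    have := congrFun h (Classical.arbitrary V)
    simp at this
  obtain ⟨v, hv0, hv⟩ := Matrix.exists_vecMul_eq_zero_iff.2 hdet
  have hb : Balanced q v := by
    intro y
    have := congrFun hv y
    simp only [Q, Matrix.vecMul, dotProduct, mul_sub, Finset.sum_sub_distrib, Pi.zero_apply,
      mul_ite, mul_zero, Finset.sum_ite_eq', Finset.mem_univ, if_true] at this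
    linarith
  have hpos : 0 < ∑ x, |v x| := by
    obtain ⟨x, hx⟩ := Function.ne_iff.1 hv0
    exact Finset.sum_pos' (fun x _ => abs_nonneg _) ⟨x, Finset.mem_univ x, abs_pos.2 hx⟩
  refine ⟨fun x => |v x| / ∑ z, |v z|, fun x => by positivity, ?_, ?_⟩
  · rw [← Finset.sum_div, div_self hpos.ne']
  · rw [stationary_iff_balanced]
    intro y
    have := hb.abs hq y
    simp only [div_mul_eq_mul_div] at this ⊢
    rw [← Finset.sum_div, this]

theorem Balanced.eq_zero_of_reaches {q : V → V → ℝ} (hq : ∀ x y, 0 ≤ q x y) {v : V → ℝ}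
    (hv : Balanced q v) (h0 : ∀ x, 0 ≤ v x) {x y : V} (h : Reaches q x y) (hy : v y = 0) :
    v x = 0 := by
  induction h using Relation.ReflTransGen.head_induction_on with
  | refl => exact hy
  | @head a c hac _ ih =>
    have h1 := hv c
    rw [ih, zero_mul] at h1
    have h2 := (Finset.sum_eq_zero_iff_of_nonneg
      (fun z _ => mul_nonneg (h0 z) (hq z c))).1 h1 a (Finset.mem_univ a)
    exact (mul_eq_zero.1 h2).resolve_right hac.ne'

theorem isInvariant_unique {q : V → V → ℝ} (hq : ∀ x y, 0 ≤ q x y) (hirr : IsIrreducibleChain q)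
    {π π' : V → ℝ} (h : IsInvariantMeasure (jumpGenerator q) π)
    (h' : IsInvariantMeasure (jumpGenerator q) π') : π = π' := by
  have b := (stationary_iff_balanced q π).1 h.stationary
  have b' := (stationary_iff_balanced q π').1 h'.stationary
  set w : V → ℝ := fun x => π x - π' x with hw
  have bw : Balanced q w := by
    intro y
    simp only [hw, sub_mul, Finset.sum_sub_distrib, b y, b' y]
  have ba := bw.abs hq
  set u : V → ℝ := fun x => |w x| + w x with hu
  have bu : Balanced q u := by
    intro y
    have h1 := ba y
    have h2 := bw y
    simp only [hu, add_mul, Finset.sum_add_distrib]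
    rw [← h1, ← h2]
  have hu0 : ∀ x, 0 ≤ u x := fun x => by
    have := neg_abs_le (w x); simp only [hu]; linarith
  have hsum : ∑ x, w x = 0 := by
    simp [hw, Finset.sum_sub_distrib, h.sum_eq_one, h'.sum_eq_one]
  have hle : ∀ x, w x ≤ 0 := by
    by_cases hex : ∃ y, u y = 0
    · obtain ⟨y, hy⟩ := hex
      intro x
      have h1 := bu.eq_zero_of_reaches hq hu0 (hirr x y) hy
      have h2 := abs_nonneg (w x)
      simp only [hu] at h1
      linarith
    · push Not at hex
      have hp : ∀ x, 0 < w x := by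
        intro x
        have h1 := lt_of_le_of_ne (hu0 x) (hex x).symm
        by_contra hc
        rw [not_lt] at hc
        simp only [hu, abs_of_nonpos hc] at h1
        linarith
      intro x
      have := Finset.sum_pos (fun x _ => hp x) ⟨x, Finset.mem_univ x⟩
      linarith
  have hz := (Finset.sum_eq_zero_iff_of_nonpos (fun x _ => hle x)).1 hsum
  funext x
  have := hz x (Finset.mem_univ x)
  simp only [hw] at this
  linarith

end Facts

section Recurrence

variable {V : Type*} [Fintype V] {q : V → V → ℝ}

theorem jumpProb_nonneg (hq : ∀ x y, 0 ≤ q x y) (x y : V) : 0 ≤ jumpProb q x y := by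
  have h : 0 ≤ ∑ z, q x z := Finset.sum_nonneg fun z _ => hq x z
  have := hq x y
  unfold jumpProb
  split_ifs <;> positivity

theorem sum_jumpProb (q : V → V → ℝ) (x : V) : ∑ y, jumpProb q x y = 1 := by
  classical
  unfold jumpProb
  by_cases h : ∑ z, q x z = 0
  · simp [h]
  · simp only [h, if_false]
    rw [← Finset.sum_div, div_self h]

theorem jumpProb_pos (hq : ∀ x y, 0 ≤ q x y) {x y : V} (h : 0 < q x y) : 0 < jumpProb q x y := by
  have h1 : 0 < ∑ z, q x z :=
    Finset.sum_pos' (fun z _ => hq x z) ⟨y, Finset.mem_univ y, h⟩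
  unfold jumpProb
  rw [if_neg h1.ne']
  positivity

theorem reaches_of_jumpProb_pos (hq : ∀ x y, 0 ≤ q x y) {x y : V} (h : 0 < jumpProb q x y) :
    Reaches q x y := by
  by_cases hxy : x = y
  · subst hxy; exact Relation.ReflTransGen.refl
  · refine Relation.ReflTransGen.single (lt_of_le_of_ne (hq x y) fun h0 => ?_)
    unfold jumpProb at h
    rw [← h0] at h
    simp [hxy] at h

theorem firstPassage_nonneg (hq : ∀ x y, 0 ≤ q x y) (x : V) (n : ℕ) (y : V) :
    0 ≤ firstPassage q x n y := by
  induction n generalizing y with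
  | zero => exact jumpProb_nonneg hq y x
  | succ n ih =>
    refine Finset.sum_nonneg fun z _ => ?_
    split_ifs
    · exact le_rfl
    · exact mul_nonneg (jumpProb_nonneg hq y z) (ih z)

theorem reaches_of_firstPassage_pos (hq : ∀ x y, 0 ≤ q x y) {x : V} {n : ℕ} {y : V}
    (h : 0 < firstPassage q x n y) : Reaches q y x := by
  induction n generalizing y with
  | zero => exact reaches_of_jumpProb_pos hq h
  | succ n ih =>
    obtain ⟨z, _, hz⟩ := Finset.exists_lt_of_sum_lt
      (show ∑ _z : V, (0 : ℝ) < firstPassage q x (n + 1) y by simpa using h)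
    split_ifs at hz
    · exact absurd hz (lt_irrefl _)
    · have h1 := jumpProb_nonneg hq y z
      have h2 := firstPassage_nonneg hq x n z
      exact (reaches_of_jumpProb_pos hq (pos_of_mul_pos_left hz h2)).trans
        (ih (pos_of_mul_pos_right hz h1))

open Classical in
theorem sum_range_firstPassage (q : V → V → ℝ) (x : V) (n : ℕ) (y : V) :
    ∑ k ∈ Finset.range (n + 1), firstPassage q x k y
      = ∑ z, jumpProb q y z *
        (if z = x then 1 else ∑ k ∈ Finset.range n, firstPassage q x k z) := by
  have h1 : ∀ z, jumpProb q y z *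
        (if z = x then 1 else ∑ k ∈ Finset.range n, firstPassage q x k z)
      = (if z = x then jumpProb q y z else 0) + ∑ k ∈ Finset.range n,
        (if z = x then 0 else jumpProb q y z * firstPassage q x k z) := by
    intro z
    split_ifs <;> simp [Finset.mul_sum]
  rw [Finset.sum_range_succ', Finset.sum_congr rfl fun z _ => h1 z, Finset.sum_add_distrib,
    Finset.sum_comm, add_comm]
  simp [firstPassage]

theorem sum_range_firstPassage_le (hq : ∀ x y, 0 ≤ q x y) (x : V) (n : ℕ) (y : V) :
    ∑ k ∈ Finset.range n, firstPassage q x k y ≤ 1 := by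
  classical
  induction n generalizing y with
  | zero => simp
  | succ n ih =>
    rw [sum_range_firstPassage]
    refine le_trans (Finset.sum_le_sum fun z _ => ?_) (sum_jumpProb q y).le
    refine mul_le_of_le_one_right (jumpProb_nonneg hq y z) ?_
    split_ifs
    · exact le_rfl
    · exact ih z

theorem summable_firstPassage (hq : ∀ x y, 0 ≤ q x y) (x y : V) :
    Summable fun n => firstPassage q x n y :=
  summable_of_sum_range_le (fun n => firstPassage_nonneg hq x n y)
    (fun n => sum_range_firstPassage_le hq x n y)

open Classical in
theorem tsum_firstPassage (hq : ∀ x y, 0 ≤ q x y) (x y : V) :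
    ∑' n, firstPassage q x n y
      = ∑ z, jumpProb q y z * (if z = x then 1 else ∑' n, firstPassage q x n z) := by
  have h1 := ((summable_firstPassage hq x y).hasSum.tendsto_sum_nat).comp (tendsto_add_atTop_nat 1)
  refine tendsto_nhds_unique h1 ?_
  have h2 : ((fun n => ∑ k ∈ Finset.range n, firstPassage q x k y) ∘ fun n => n + 1)
      = fun n => ∑ z, jumpProb q y z *
        (if z = x then 1 else ∑ k ∈ Finset.range n, firstPassage q x k z) := by
    funext n
    exact sum_range_firstPassage q x n y
  rw [h2]
  refine tendsto_finsetSum _ fun z _ => Tendsto.const_mul _ ?_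
  split_ifs
  · exact tendsto_const_nhds
  · exact (summable_firstPassage hq x z).hasSum.tendsto_sum_nat

/-- A state of a finite chain is recurrent if and only if it can be reached from every state that
it reaches. -/
theorem isRecurrent_iff (hq : ∀ x y, 0 ≤ q x y) (x : V) :
    IsRecurrent q x ↔ ∀ y, Reaches q x y → Reaches q y x := by
  classical
  set u : V → ℝ := fun y => ∑' n, firstPassage q x n y with hu
  set g : V → ℝ := fun z => if z = x then 1 else u z with hg
  have hug : ∀ y, u y = ∑ z, jumpProb q y z * g z := fun y => tsum_firstPassage hq x y
  have hu1 : ∀ y, u y ≤ 1 := fun y =>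
    Real.tsum_le_of_sum_range_le (fun n => firstPassage_nonneg hq x n y)
      (fun n => sum_range_firstPassage_le hq x n y)
  have hg1 : ∀ y, g y ≤ 1 := fun y => by
    simp only [hg]; split_ifs
    · exact le_rfl
    · exact hu1 y
  have hP := jumpProb_nonneg hq
  have hrec : IsRecurrent q x ↔ u x = 1 := by
    refine ⟨fun h => h.tsum_eq, fun h => ?_⟩
    have := (summable_firstPassage hq x x).hasSum
    unfold IsRecurrent
    rw [← h]
    exact this
  rw [hrec]
  constructor
  · intro hx y hy
    have key : u y = 1 := by
      induction hy with
      | refl => exact hx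
      | @tail b c _ hbc ih =>
        have h1 : ∑ z, jumpProb q b z * g z = ∑ z, jumpProb q b z := by
          rw [← hug, ih, sum_jumpProb]
        have h2 := (Finset.sum_eq_sum_iff_of_le
          (fun z _ => mul_le_of_le_one_right (hP b z) (hg1 z))).1 h1 c (Finset.mem_univ c)
        have h3 : g c = 1 := by
          have := jumpProb_pos hq hbc
          exact mul_left_cancel₀ this.ne' (h2.trans (mul_one _).symm)
        by_cases hc : c = x
        · rw [hc, hx]
        · simpa [hg, hc] using h3
    by_contra hcon
    have hz : ∀ n, firstPassage q x n y = 0 := fun n =>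
      le_antisymm (not_lt.1 fun h => hcon (reaches_of_firstPassage_pos hq h))
        (firstPassage_nonneg hq x n y)
    simp [hu, hz] at key
  · intro hess
    obtain ⟨y0, hy0, hmin⟩ := (Finset.univ.filter fun y => Reaches q x y).exists_min_image u
      ⟨x, by simp only [Finset.mem_filter, Finset.mem_univ, true_and]; exact .refl⟩
    simp only [Finset.mem_filter, Finset.mem_univ, true_and] at hy0 hmin
    by_contra hx
    have hm : u y0 < 1 := lt_of_le_of_lt (hmin x .refl) (lt_of_le_of_ne (hu1 x) hx)
    have step : ∀ b, Reaches q x b → u b = u y0 → ∀ c, 0 < jumpProb q b c →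
        c ≠ x ∧ u c = u y0 ∧ Reaches q x c := by
      intro b hb hub c hc
      have hle : ∀ z ∈ (Finset.univ : Finset V),
          jumpProb q b z * u y0 ≤ jumpProb q b z * g z := by
        intro z _
        rcases (hP b z).eq_or_lt with h0 | h0
        · simp [← h0]
        · refine mul_le_mul_of_nonneg_left ?_ h0.le
          simp only [hg]; split_ifs
          · exact hm.le
          · exact hmin z (hb.trans (reaches_of_jumpProb_pos hq h0))
      have h1 : ∑ z, jumpProb q b z * u y0 = ∑ z, jumpProb q b z * g z := by
        rw [← hug, hub, ← Finset.sum_mul, sum_jumpProb, one_mul]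
      have h2 := (Finset.sum_eq_sum_iff_of_le hle).1 h1 c (Finset.mem_univ c)
      have h3 : u y0 = g c := mul_left_cancel₀ hc.ne' h2
      have hcx : c ≠ x := by
        rintro rfl
        simp only [hg, if_true] at h3
        linarith
      refine ⟨hcx, ?_, hb.trans (reaches_of_jumpProb_pos hq hc)⟩
      simpa [hg, hcx] using h3.symm
    obtain ⟨z, _, hz⟩ := Finset.exists_lt_of_sum_lt
      (show ∑ _z : V, (0 : ℝ) < ∑ z, jumpProb q y0 z by rw [sum_jumpProb]; simp)
    obtain ⟨hzx, huz, hrz⟩ := step y0 hy0 rfl z hz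
    have all : ∀ w, Reaches q z w → w ≠ x ∧ u w = u y0 ∧ Reaches q x w := by
      intro w hw
      induction hw with
      | refl => exact ⟨hzx, huz, hrz⟩
      | @tail b c _ hbc ih => exact step b ih.2.2 ih.2.1 c (jumpProb_pos hq hbc)
    exact (all x (hess z hrz)).1 rfl

end Recurrence

section InclusionFacts

variable {S : Type*} [Fintype S] [DecidableEq S]

theorem move_apply {N : ℕ} (η : Config S N) {x y : S} (hx : η.1 x ≠ 0) (hxy : x ≠ y) (z : S) :
    (move η x y).1 z = if z = x then η.1 x - 1 else if z = y then η.1 y + 1 else η.1 z := by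
  have : ¬(η.1 x = 0 ∨ x = y) := not_or.2 ⟨hx, hxy⟩
  simp [move, this]

/-- The transition rates of the inclusion process. -/
def inclusionRate (r : S → S → ℝ) (δ : ℝ) (N : ℕ) (η η' : Config S N) : ℝ :=
  ∑ x, ∑ y, if move η x y = η' then (η.1 x : ℝ) * (δ + (η.1 y : ℝ)) * r x y else 0

theorem jumpGenerator_inclusionRate (r : S → S → ℝ) (δ : ℝ) (N : ℕ) :
    jumpGenerator (inclusionRate r δ N) = inclusionGenerator r δ N := by
  funext F η
  simp only [jumpGenerator, inclusionRate, inclusionGenerator, Finset.sum_mul]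
  rw [Finset.sum_comm]
  refine Finset.sum_congr rfl fun x _ => ?_
  rw [Finset.sum_comm]
  refine Finset.sum_congr rfl fun y _ => ?_
  simp [ite_mul]

theorem inclusionRate_nonneg {r : S → S → ℝ} (hr : ∀ x y, 0 ≤ r x y) {δ : ℝ} (hδ : 0 < δ) (N : ℕ)
    (η η' : Config S N) : 0 ≤ inclusionRate r δ N η η' := by
  refine Finset.sum_nonneg fun x _ => Finset.sum_nonneg fun y _ => ?_
  have := hr x y
  split_ifs <;> positivity

theorem inclusionRate_move_pos {r : S → S → ℝ} (hr : ∀ x y, 0 ≤ r x y) {δ : ℝ} (hδ : 0 < δ)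
    {N : ℕ} (η : Config S N) {x y : S} (hx : η.1 x ≠ 0) (hxy : 0 < r x y) :
    0 < inclusionRate r δ N η (move η x y) := by
  have hnn : ∀ a b, 0 ≤ (if move η a b = move η x y then
      (η.1 a : ℝ) * (δ + (η.1 b : ℝ)) * r a b else 0) := by
    intro a b
    have := hr a b
    split_ifs <;> positivity
  refine Finset.sum_pos' (fun a _ => Finset.sum_nonneg fun b _ => hnn a b)
    ⟨x, Finset.mem_univ x, Finset.sum_pos' (fun b _ => hnn x b) ⟨y, Finset.mem_univ y, ?_⟩⟩
  have : (0 : ℝ) < η.1 x := by exact_mod_cast Nat.pos_of_ne_zero hx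
  simp only [if_true]
  positivity

theorem reaches_move {r : S → S → ℝ} (hr : ∀ x y, 0 ≤ r x y) {δ : ℝ} (hδ : 0 < δ)
    {N : ℕ} (η : Config S N) {x y : S} (hx : η.1 x ≠ 0) (hxy : Reaches r x y) :
    Reaches (inclusionRate r δ N) η (move η x y) := by
  induction hxy with
  | refl =>
    have : move η x x = η := by simp [move]
    rw [this]
    exact Relation.ReflTransGen.refl
  | @tail b c _ hbc ih =>
    by_cases hxb : x = b
    · subst hxb
      exact Relation.ReflTransGen.single (inclusionRate_move_pos hr hδ η hx hbc)
    by_cases hcb : b = c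
    · subst hcb
      exact ih
    have hb : (move η x b).1 b ≠ 0 := by
      rw [move_apply η hx hxb]
      simp [Ne.symm hxb]
    have heq : move (move η x b) b c = move η x c := by
      apply Subtype.ext
      funext z
      rw [move_apply _ hb hcb]
      simp only [move_apply η hx hxb]
      by_cases hxc : x = c
      · subst hxc
        have hm : move η x x = η := by simp [move]
        rw [hm]
        by_cases h1 : z = b
        · subst h1; simp [hcb]
        · by_cases h2 : z = x
          · subst h2; simp [h1]; omega
          · simp [h1, h2]
      · rw [move_apply η hx hxc]
        by_cases h1 : z = b
        · subst h1; simp [Ne.symm hxb, hcb]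
        · by_cases h2 : z = x
          · subst h2; simp [h1, hxc]
          · by_cases h3 : z = c
            · subst h3; simp [h1, h2]
            · simp [h1, h2, h3]
    rw [← heq]
    exact Relation.ReflTransGen.tail ih (inclusionRate_move_pos hr hδ _ hb hbc)

theorem isIrreducible_inclusionRate {r : S → S → ℝ} (hr : ∀ x y, 0 ≤ r x y)
    (hirr : IsIrreducibleChain r) {δ : ℝ} (hδ : 0 < δ) (N : ℕ) :
    IsIrreducibleChain (inclusionRate r δ N) := by
  intro η η'
  obtain ⟨n, hn⟩ : ∃ n, ∑ x, (η.1 x - η'.1 x) = n := ⟨_, rfl⟩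
  induction n using Nat.strong_induction_on generalizing η with
  | _ n ih =>
    by_cases heq : η = η'
    · subst heq; exact Relation.ReflTransGen.refl
    obtain ⟨x, hx⟩ : ∃ x, η'.1 x < η.1 x := by
      by_contra hc
      push Not at hc
      refine heq (Subtype.ext (funext fun z => ?_))
      exact (Finset.sum_eq_sum_iff_of_le fun z _ => hc z).1 (η.2.trans η'.2.symm) z
        (Finset.mem_univ z)
    obtain ⟨y, hy⟩ : ∃ y, η.1 y < η'.1 y := by
      by_contra hc
      push Not at hc
      refine heq (Subtype.ext (funext fun z => ?_))
      exact ((Finset.sum_eq_sum_iff_of_le fun z _ => hc z).1 (η'.2.trans η.2.symm) z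
        (Finset.mem_univ z)).symm
    have hx0 : η.1 x ≠ 0 := by omega
    have hxy : x ≠ y := by rintro rfl; omega
    refine Relation.ReflTransGen.trans (reaches_move hr hδ η hx0 (hirr x y))
      (ih _ ?_ (move η x y) rfl)
    rw [← hn]
    refine Finset.sum_lt_sum (fun z _ => ?_) ⟨x, Finset.mem_univ x, ?_⟩
    · rw [move_apply η hx0 hxy]
      split_ifs with h1 h2
      · subst h1; omega
      · subst h2; omega
      · exact le_rfl
    · rw [move_apply η hx0 hxy]
      simp only [if_true]
      omega

theorem isInvariant_inclusionMeasure [Nonempty S] {r : S → S → ℝ} (hr : ∀ x y, 0 ≤ r x y) {δ : ℝ}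
    (hδ : 0 < δ) (N : ℕ) :
    IsInvariantMeasure (inclusionGenerator r δ N) (inclusionMeasure r δ N) := by
  have : Nonempty (Config S N) := ⟨condensed N (Classical.arbitrary S)⟩
  have h := exists_isInvariant (inclusionRate_nonneg hr hδ N)
  rw [jumpGenerator_inclusionRate] at h
  exact Classical.epsilon_spec h

theorem inclusionMeasure_unique [Nonempty S] {r : S → S → ℝ} (hr : ∀ x y, 0 ≤ r x y)
    (hirr : IsIrreducibleChain r) {δ : ℝ} (hδ : 0 < δ) (N : ℕ) {π : Config S N → ℝ}
    (hπ : IsInvariantMeasure (inclusionGenerator r δ N) π) : π = inclusionMeasure r δ N := by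
  have h := isInvariant_inclusionMeasure hr hδ N
  rw [← jumpGenerator_inclusionRate] at h hπ
  exact isInvariant_unique (inclusionRate_nonneg hr hδ N)
    (isIrreducible_inclusionRate hr hirr hδ N) hπ h

end InclusionFacts

end InclusionProcess

end

open InclusionProcess

/-!
Write `μ` for the invariant measure with `N` particles, `ξ^x` for the configuration condensed at
`x` and `b` for `asymRate r`.  By compactness it is enough to identify every limit point `m` of the
vectors `(μ(ξ^x))_x`; condensation says that such an `m` has total mass one.

The key tool is `tube_inequality`.  A test function `F ≥ 0` which is supported on the tube of
configurations living on two sites `x, y` has a nonnegative generator off the tube, so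
stationarity `∑ μ(η) L F(η) = 0` bounds the sum over the tube alone from above, and nothing has to
be known about configurations on three or more sites.  On the tube the inclusion process is a
nearest neighbour walk with rates proportional to `r x y` and `r y x`, sped up by
`η x * η y`; the corrections (jumps that leave the tube, and the diffusive part of the rates) are
of order `N d_N`, and are weighted by the vanishing mass of the configurations that are not
condensed.  Hence they are negligible against the rates `N d_N r x y` at which the condensate emits
particles.

With profiles that are essentially the hitting probabilities of the walk
(`exists_passage_profile`), and with the balance of flows at `ξ^x` (`condensed_balance`), this gives
`∑ y, m y * b y x ≤ m x * ∑ y, b x y` for each `x`.  Both sides have the same sum over `x`, so `m` is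
balanced for `b` (`balanced_asymRate_of_tendsto`), and in particular it vanishes off the recurrent
set.  If `b` is irreducible there, `m` is determined.

In the symmetric case `b` vanishes on the recurrent set `A`, and a finer scale is needed.  For
`z ∈ A` the particle number `η z` has generator
`∑ a, (d_N (r a z η a - r z a η z) + (r a z - r z a) η a η z)`.  The quadratic terms with `a ∈ A`
vanish.  For `a ∉ A`, the tube inequality with the profile of `exists_excursion_profile` bounds the
quadratic term from below by `d_N N r z a μ(ξ^z)` up to `o(d_N N)`, which cancels the loss from `z`
to `a`.  What remains is `∑ a ∈ A, r a z * (m a - m z) ≤ 0`; again both sides have the same sum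
over `z ∈ A`, so `m` is invariant for `r` on `A` (`balanced_restrictRate_of_tendsto`).
-/

namespace InclusionProcess

/-! ### Test functions supported on a tube -/

section Tubes

variable {S : Type*} [Fintype S]

/-- The function on configurations which is `φ (η y)` on the tube `η x + η y = N` of
configurations living on `{x, y}`, and zero elsewhere. -/
def tubeFun (N : ℕ) (x y : S) (φ : ℕ → ℝ) (η : Config S N) : ℝ :=
  if η.1 x + η.1 y = N then φ (η.1 y) else 0

theorem tubeFun_nonneg {N : ℕ} (x y : S) {φ : ℕ → ℝ} (hφ : ∀ i, 0 ≤ φ i) (η : Config S N) :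
    0 ≤ tubeFun N x y φ η := by
  unfold tubeFun
  split_ifs
  · exact hφ _
  · exact le_rfl

theorem apply_le {N : ℕ} (η : Config S N) (x : S) : η.1 x ≤ N := by
  have := Finset.single_le_sum (f := η.1) (fun _ _ => Nat.zero_le _) (Finset.mem_univ x)
  rwa [η.2] at this

variable [DecidableEq S]

theorem move_self {N : ℕ} (η : Config S N) (x : S) : move η x x = η := by simp [move]

theorem move_of_eq_zero {N : ℕ} (η : Config S N) {x : S} (hx : η.1 x = 0) (y : S) :
    move η x y = η := by simp [move, hx]

theorem add_le_of_ne {N : ℕ} (η : Config S N) {x y : S} (hxy : x ≠ y) : η.1 x + η.1 y ≤ N := by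
  have := Finset.sum_le_sum_of_subset (f := η.1) (Finset.subset_univ {x, y})
  rwa [Finset.sum_pair hxy, η.2] at this

theorem apply_eq_zero_of_tube {N : ℕ} {η : Config S N} {x y : S} (hxy : x ≠ y)
    (h : η.1 x + η.1 y = N) {z : S} (hzx : z ≠ x) (hzy : z ≠ y) : η.1 z = 0 := by
  have := Finset.sum_le_sum_of_subset (f := η.1) (Finset.subset_univ {z, x, y})
  rw [Finset.sum_insert (by simp [hzx, hzy]), Finset.sum_pair hxy, η.2] at this
  omega

theorem eq_condensed_iff {N : ℕ} (η : Config S N) (x : S) : η = condensed N x ↔ η.1 x = N := by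
  constructor
  · rintro rfl
    simp [condensed]
  · intro h
    refine Subtype.ext (funext fun z => ?_)
    by_cases hz : z = x
    · subst hz; simp [condensed, h]
    · have := add_le_of_ne η hz
      simp only [condensed, hz, if_false]
      omega

/-- On a tube the generator acts on a tube function like the generator of a nearest neighbour
walk in `η y`, with speed `η x * η y`, up to errors of order `N * δ`: these come from
the diffusive part of the rates, and from jumps that leave the tube. -/
theorem inclusionGenerator_tubeFun_ge {r : S → S → ℝ} (hr : ∀ x y, 0 ≤ r x y) {δ : ℝ} (hδ : 0 < δ)
    {N : ℕ} {x y : S} (hxy : x ≠ y) {φ : ℕ → ℝ} (hφ : ∀ i, 0 ≤ φ i) (η : Config S N)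
    (hη : η.1 x + η.1 y = N) :
    (η.1 x : ℝ) * η.1 y *
        (r x y * φ (η.1 y + 1) + r y x * φ (η.1 y - 1) - (r x y + r y x) * φ (η.1 y))
      + δ * η.1 x * r x y * φ (η.1 y + 1) + δ * η.1 y * r y x * φ (η.1 y - 1)
      - N * δ * (∑ a, ∑ b, r a b) * φ (η.1 y)
      ≤ inclusionGenerator r δ N (tubeFun N x y φ) η := by
  have hyx : y ≠ x := hxy.symm
  have hval : tubeFun N x y φ η = φ (η.1 y) := by simp [tubeFun, hη]
  have hNx : ((η.1 x : ℕ) : ℝ) ≤ N := by exact_mod_cast apply_le η x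
  have hNy : ((η.1 y : ℕ) : ℝ) ≤ N := by exact_mod_cast apply_le η y
  -- each pair of sites is compared with the walk term it contributes, if any
  have key : ∀ a b,
      (if a = x then (if b = y then
          (η.1 x : ℝ) * η.1 y * (r x y * φ (η.1 y + 1) - r x y * φ (η.1 y))
          + δ * η.1 x * r x y * φ (η.1 y + 1) else 0) else 0)
      + (if a = y then (if b = x then
          (η.1 x : ℝ) * η.1 y * (r y x * φ (η.1 y - 1) - r y x * φ (η.1 y))
          + δ * η.1 y * r y x * φ (η.1 y - 1) else 0) else 0)
      - N * δ * φ (η.1 y) * r a b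
      ≤ (η.1 a : ℝ) * (δ + (η.1 b : ℝ)) * r a b *
        (tubeFun N x y φ (move η a b) - tubeFun N x y φ η) := by
    intro a b
    have h0 := hφ (η.1 y)
    have hrab := hr a b
    have hmv := tubeFun_nonneg x y hφ (move η a b)
    have herr : 0 ≤ N * δ * φ (η.1 y) * r a b := by positivity
    by_cases hab : a = b
    · subst hab
      by_cases h1 : a = x
      · subst h1; simpa [move_self, hxy] using herr
      · by_cases h2 : a = y
        · subst h2; simpa [move_self, hyx] using herr
        · simpa [move_self, h1, h2] using herr
    by_cases ha0 : η.1 a = 0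
    · rw [move_of_eq_zero η ha0, sub_self, mul_zero]
      by_cases h1 : a = x
      · subst h1; simpa [ha0, hxy] using herr
      · by_cases h2 : a = y
        · subst h2; simpa [ha0, hyx] using herr
        · simpa [h1, h2] using herr
    have hm := move_apply η ha0 hab
    by_cases h1 : a = x
    · subst h1
      by_cases h3 : b = y
      · subst h3
        have e : tubeFun N a b φ (move η a b) = φ (η.1 b + 1) := by
          have : (η.1 a - 1) + (η.1 b + 1) = N := by omega
          simp [tubeFun, hm, hyx, this]
        rw [e, hval]
        simp only [if_true, hxy, if_false]
        have : δ * η.1 a * (r a b * φ (η.1 b)) ≤ N * δ * φ (η.1 b) * r a b := by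
          have := mul_le_mul_of_nonneg_right hNx (show 0 ≤ δ * (r a b * φ (η.1 b)) by positivity)
          linarith
        linarith
      · have e : η.1 b = 0 := apply_eq_zero_of_tube hxy hη (Ne.symm hab) h3
        rw [hval, e]
        simp only [if_true, h3, if_false, hxy]
        have h5 : 0 ≤ (η.1 a : ℝ) * δ * r a b * tubeFun N a y φ (move η a b) := by positivity
        have := mul_le_mul_of_nonneg_right hNx (show 0 ≤ δ * (r a b * φ (η.1 y)) by positivity)
        push_cast
        linarith
    · by_cases h2 : a = y
      · subst h2
        by_cases h3 : b = x
        · subst h3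
          have e : tubeFun N b a φ (move η a b) = φ (η.1 a - 1) := by
            have : (η.1 b + 1) + (η.1 a - 1) = N := by omega
            simp [tubeFun, hm, hxy, this]
          rw [e, hval]
          simp only [if_true, h1, if_false]
          have : δ * η.1 a * (r a b * φ (η.1 a)) ≤ N * δ * φ (η.1 a) * r a b := by
            have := mul_le_mul_of_nonneg_right hNy (show 0 ≤ δ * (r a b * φ (η.1 a)) by positivity)
            linarith
          linarith
        · have e : η.1 b = 0 := apply_eq_zero_of_tube hxy hη h3 (Ne.symm hab)
          rw [hval, e]
          simp only [if_true, h3, if_false, h1]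
          have h5 : 0 ≤ (η.1 a : ℝ) * δ * r a b * tubeFun N x a φ (move η a b) := by positivity
          have := mul_le_mul_of_nonneg_right hNy (show 0 ≤ δ * (r a b * φ (η.1 a)) by positivity)
          push_cast
          linarith
      · exact absurd (apply_eq_zero_of_tube hxy hη h1 h2) ha0
  have hsum := Finset.sum_le_sum fun a (_ : a ∈ Finset.univ) =>
    Finset.sum_le_sum fun b (_ : b ∈ Finset.univ) => key a b
  unfold inclusionGenerator
  refine le_trans (le_of_eq ?_) hsum
  simp only [Finset.sum_sub_distrib, Finset.sum_add_distrib, ← Finset.mul_sum]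
  have hite : ∀ (p q : S) (c : ℝ),
      ∑ a, ∑ b, (if a = p then (if b = q then c else 0) else 0) = c := by
    intro p q c
    rw [Finset.sum_eq_single p (fun a _ ha => by simp [ha]) (by simp)]
    simp
  rw [hite, hite]
  ring

theorem inclusionGenerator_nonneg_of_eq_zero {r : S → S → ℝ} (hr : ∀ x y, 0 ≤ r x y) {δ : ℝ}
    (hδ : 0 < δ) {N : ℕ} {F : Config S N → ℝ} (hF : ∀ η, 0 ≤ F η) {η : Config S N} (hη : F η = 0) :
    0 ≤ inclusionGenerator r δ N F η := by
  refine Finset.sum_nonneg fun a _ => Finset.sum_nonneg fun b _ => ?_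
  have := hr a b
  have := hF (move η a b)
  rw [hη, sub_zero]
  positivity

theorem condensed_injective {N : ℕ} (hN : N ≠ 0) :
    Function.Injective (condensed N : S → Config S N) := by
  intro x y h
  have h1 := (eq_condensed_iff _ _).1 h
  by_contra hne
  simp [condensed, Ne.symm hne] at h1
  exact hN h1.symm

/-- The mass that a measure gives to the configurations that occupy at least two sites. -/
def spreadMass (N : ℕ) (μ : Config S N → ℝ) : ℝ :=
  1 - ∑ x, μ (condensed N x)

theorem sum_eq_condensed_add {N : ℕ} (hN : N ≠ 0) (g : Config S N → ℝ) :
    ∑ η, g η = ∑ x, g (condensed N x) + ∑ η ∈ (condensedSet S N)ᶜ, g η := by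
  rw [← Finset.sum_add_sum_compl (condensedSet S N)]
  congr 1
  unfold condensedSet
  rw [Finset.sum_image fun a _ b _ h => condensed_injective hN h]

theorem spreadMass_eq {N : ℕ} (hN : N ≠ 0) {μ : Config S N → ℝ} (hμ : ∑ η, μ η = 1) :
    spreadMass N μ = ∑ η ∈ (condensedSet S N)ᶜ, μ η := by
  have := sum_eq_condensed_add hN μ
  unfold spreadMass
  linarith

theorem spreadMass_nonneg {N : ℕ} (hN : N ≠ 0) {μ : Config S N → ℝ} (hμ : ∑ η, μ η = 1)
    (h0 : ∀ η, 0 ≤ μ η) : 0 ≤ spreadMass N μ := by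
  rw [spreadMass_eq hN hμ]
  exact Finset.sum_nonneg fun η _ => h0 η

/-- The pointwise form of `tube_inequality`.  The two ends of the tube, where `φ` vanishes, receive
no error term. -/
theorem tube_pointwise {r : S → S → ℝ} (hr : ∀ x y, 0 ≤ r x y) {δ : ℝ} (hδ : 0 < δ)
    {N : ℕ} (hN : N ≠ 0) {x y : S} (hxy : x ≠ y) {φ κ : ℕ → ℝ} {B : ℝ} (hφ : ∀ i, 0 ≤ φ i)
    (hφ0 : φ 0 = 0) (hφN : φ N = 0) (hφB : ∀ i, φ i ≤ B)
    (hκ : ∀ i, 1 ≤ i → i < N →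
      -κ i ≤ r x y * φ (i + 1) + r y x * φ (i - 1) - (r x y + r y x) * φ i) (η : Config S N) :
    (if η = condensed N x then δ * N * (r x y * φ 1) else 0)
        + (if η = condensed N y then δ * N * (r y x * φ (N - 1)) else 0)
      ≤ inclusionGenerator r δ N (tubeFun N x y φ) η
        + (if η.1 x + η.1 y = N then (η.1 x : ℝ) * η.1 y * κ (η.1 y) else 0)
        + (if η ∈ (condensedSet S N)ᶜ then N * δ * (∑ a, ∑ b, r a b) * B else 0) := by
  have hR0 : 0 ≤ ∑ a, ∑ b, r a b :=
    Finset.sum_nonneg fun a _ => Finset.sum_nonneg fun b _ => hr a b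
  have hgen := inclusionGenerator_tubeFun_ge hr hδ (N := N) hxy hφ
  generalize (∑ a, ∑ b, r a b) = R at hR0 hgen ⊢
  have hB : 0 ≤ B := (hφ 0).trans (hφB 0)
  have herr : 0 ≤ N * δ * R * B := by positivity
  have herr' : (0 : ℝ) ≤ if η ∈ (condensedSet S N)ᶜ then N * δ * R * B else 0 := by
    split_ifs
    · exact herr
    · exact le_rfl
  by_cases hη : η.1 x + η.1 y = N
  · have h1 := hgen η hη
    rw [if_pos hη]
    simp only [eq_condensed_iff]
    by_cases hx : η.1 x = N
    · have hy : η.1 y = 0 := by omega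
      rw [hx, hy, hφ0] at h1
      rw [if_pos hx, if_neg (by omega), hy]
      simp only [CharP.cast_eq_zero, mul_zero, zero_mul] at h1 ⊢
      simp only [zero_add] at h1
      linarith only [h1, herr']
    · by_cases hy : η.1 y = N
      · have hx0 : η.1 x = 0 := by omega
        rw [hx0, hy, hφN] at h1
        rw [if_neg hx, if_pos hy, hx0]
        simp only [CharP.cast_eq_zero, mul_zero, zero_mul] at h1 ⊢
        linarith only [h1, herr']
      · rw [if_neg hx, if_neg hy]
        have hmem : η ∈ (condensedSet S N)ᶜ := by
          simp only [condensedSet, Finset.mem_compl, Finset.mem_image, Finset.mem_univ, true_and,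
            not_exists]
          rintro z rfl
          have hzx : z ≠ x := by rintro rfl; simp [condensed] at hx
          have hzy : z ≠ y := by rintro rfl; simp [condensed] at hy
          simp [condensed, hzx.symm, hzy.symm] at hη
          exact hN hη.symm
        rw [if_pos hmem]
        have h2 := hκ (η.1 y) (by omega) (by omega)
        have h3 := mul_le_mul_of_nonneg_left h2
          (mul_nonneg (Nat.cast_nonneg (η.1 x)) (Nat.cast_nonneg (η.1 y)) :
            (0 : ℝ) ≤ (η.1 x : ℝ) * η.1 y)
        have h4 := mul_le_mul_of_nonneg_left (hφB (η.1 y))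
          (mul_nonneg (mul_nonneg (Nat.cast_nonneg N) hδ.le) hR0)
        have h5 : 0 ≤ δ * η.1 x * r x y * φ (η.1 y + 1) :=
          mul_nonneg (mul_nonneg (mul_nonneg hδ.le (Nat.cast_nonneg _)) (hr x y)) (hφ _)
        have h6 : 0 ≤ δ * η.1 y * r y x * φ (η.1 y - 1) :=
          mul_nonneg (mul_nonneg (mul_nonneg hδ.le (Nat.cast_nonneg _)) (hr y x)) (hφ _)
        linarith only [h1, h3, h4, h5, h6]
  · have h1 := inclusionGenerator_nonneg_of_eq_zero hr hδ (tubeFun_nonneg x y hφ)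
      (show tubeFun N x y φ η = 0 by simp [tubeFun, hη])
    rw [if_neg hη, if_neg, if_neg]
    · linarith only [h1, herr']
    · rw [eq_condensed_iff]
      have := add_le_of_ne η hxy
      omega
    · rw [eq_condensed_iff]
      have := add_le_of_ne η hxy
      omega

/-- The balance between two condensed configurations `ξ^x` and `ξ^y`, tested with a profile `φ`
along the tube that joins them.  Nothing is assumed about the rest of the configuration space: a
nonnegative test function that vanishes off the tube has a nonnegative generator there. -/
theorem tube_inequality {r : S → S → ℝ} (hr : ∀ x y, 0 ≤ r x y) {δ : ℝ} (hδ : 0 < δ)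
    {N : ℕ} (hN : N ≠ 0) {μ : Config S N → ℝ}
    (hμ : IsInvariantMeasure (inclusionGenerator r δ N) μ)
    {x y : S} (hxy : x ≠ y) {φ κ : ℕ → ℝ} {B : ℝ} (hφ : ∀ i, 0 ≤ φ i) (hφ0 : φ 0 = 0)
    (hφN : φ N = 0) (hφB : ∀ i, φ i ≤ B)
    (hκ : ∀ i, 1 ≤ i → i < N →
      -κ i ≤ r x y * φ (i + 1) + r y x * φ (i - 1) - (r x y + r y x) * φ i) :
    δ * N * (r x y * φ 1 * μ (condensed N x) + r y x * φ (N - 1) * μ (condensed N y))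
      ≤ ∑ η, μ η * (if η.1 x + η.1 y = N then (η.1 x : ℝ) * η.1 y * κ (η.1 y) else 0)
        + N * δ * (∑ a, ∑ b, r a b) * B * spreadMass N μ := by
  have point := tube_pointwise hr hδ hN hxy hφ hφ0 hφN hφB hκ
  generalize (∑ a, ∑ b, r a b) = R at point ⊢
  have hsum := Finset.sum_le_sum fun η (_ : η ∈ Finset.univ) =>
    mul_le_mul_of_nonneg_left (point η) (hμ.nonneg η)
  simp only [mul_add, Finset.sum_add_distrib, hμ.stationary, mul_ite, mul_zero] at hsum
  rw [Finset.sum_ite_eq', Finset.sum_ite_eq', ← Finset.sum_filter (· ∈ (condensedSet S N)ᶜ),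
    Finset.filter_mem_eq_inter, Finset.univ_inter, ← Finset.sum_mul,
    ← spreadMass_eq hN hμ.sum_eq_one] at hsum
  simp only [Finset.mem_univ, if_true, mul_ite, mul_zero, zero_add] at hsum ⊢
  linarith

/-- The flow into `ξ^x` from the configurations with a single particle away from `x` is at most
the flow out of `ξ^x`. -/
theorem condensed_balance {r : S → S → ℝ} (hr : ∀ x y, 0 ≤ r x y) (hdiag : ∀ x, r x x = 0) {δ : ℝ}
    (hδ : 0 < δ) {N : ℕ} (hN : 2 ≤ N) {μ : Config S N → ℝ}
    (hμ : IsInvariantMeasure (inclusionGenerator r δ N) μ) (x : S) :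
    ∑ y, ∑ η, μ η * (if η.1 x + η.1 y = N then
        (η.1 x : ℝ) * η.1 y * (if η.1 y = 1 then r y x else 0) else 0)
      ≤ δ * N * (∑ y, r x y) * μ (condensed N x) := by
  have point : ∀ η : Config S N,
      ∑ y, (if η.1 x + η.1 y = N then
        (η.1 x : ℝ) * η.1 y * (if η.1 y = 1 then r y x else 0) else 0)
      ≤ inclusionGenerator r δ N (fun ζ => if ζ = condensed N x then 1 else 0) η
        + if η = condensed N x then δ * N * ∑ y, r x y else 0 := by
    intro η
    by_cases hη : η = condensed N x
    · subst hη
      rw [if_pos rfl]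
      have h1 : inclusionGenerator r δ N (fun ζ => if ζ = condensed N x then 1 else 0)
          (condensed N x) = -(δ * N * ∑ y, r x y) := by
        unfold inclusionGenerator
        rw [Finset.sum_eq_single x _ (by simp), Finset.mul_sum, ← Finset.sum_neg_distrib]
        · refine Finset.sum_congr rfl fun y _ => ?_
          by_cases hxy : x = y
          · subst hxy; simp [hdiag]
          · have h2 : (condensed N x).1 x ≠ 0 := by simp [condensed]; omega
            have h3 : move (condensed N x) x y ≠ condensed N x := by
              rw [Ne, eq_condensed_iff, move_apply _ h2 hxy]
              simp [condensed]; omega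
            simp only [h3, if_false, if_true]
            have h4 : (condensed N x).1 x = N := by simp [condensed]
            have h5 : (condensed N x).1 y = 0 := by simp [condensed, Ne.symm hxy]
            rw [h4, h5]
            push_cast
            ring
        · intro a _ ha
          refine Finset.sum_eq_zero fun b _ => ?_
          simp [condensed, ha]
      rw [h1]
      refine le_of_eq ?_
      rw [neg_add_cancel]
      refine Finset.sum_eq_zero fun y _ => ?_
      by_cases hxy : y = x
      · subst hxy
        rw [if_neg]
        simp [condensed]; omega
      · simp [condensed, hxy]
    · rw [if_neg hη, add_zero]
      unfold inclusionGenerator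
      refine Finset.sum_le_sum fun y _ => ?_
      have hnn : ∀ b ∈ Finset.univ, 0 ≤ (η.1 y : ℝ) * (δ + (η.1 b : ℝ)) * r y b *
          ((fun ζ => if ζ = condensed N x then (1 : ℝ) else 0) (move η y b)
            - (fun ζ => if ζ = condensed N x then (1 : ℝ) else 0) η) := by
        intro b _
        have := hr y b
        simp only [hη, if_false, sub_zero]
        split_ifs <;> positivity
      refine le_trans ?_ (Finset.single_le_sum hnn (Finset.mem_univ x))
      split_ifs with h1 h2
      · by_cases hyx : y = x
        · subst hyx; simp [hdiag]
        have h3 : move η y x = condensed N x := by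
          rw [eq_condensed_iff, move_apply η (by omega) hyx]
          simp [Ne.symm hyx]; omega
        simp only [h3, hη, if_true, if_false, h2]
        have := hr y x
        have : 0 ≤ δ * r y x := by positivity
        push_cast
        linarith
      · simpa using hnn x (Finset.mem_univ x)
      · exact hnn x (Finset.mem_univ x)
  have hsum := Finset.sum_le_sum fun η (_ : η ∈ Finset.univ) =>
    mul_le_mul_of_nonneg_left (point η) (hμ.nonneg η)
  simp only [mul_add, Finset.sum_add_distrib, hμ.stationary, zero_add] at hsum
  have hc : ∑ η, μ η * (if η = condensed N x then δ * N * ∑ y, r x y else 0)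
      = μ (condensed N x) * (δ * N * ∑ y, r x y) := by simp
  rw [hc] at hsum
  rw [Finset.sum_comm]
  simp_rw [← Finset.mul_sum]
  linarith only [hsum]

end Tubes

/-! ### Walk profiles along a tube -/

section Profiles

/-- A convex profile for the walk with jump rates `r` upwards and `s` downwards on `{0, …, N}`,
with its value at the left endpoint set to `0`: as the value there is at most `1`, this costs at
most `s` in the convexity inequality at `1`. -/
theorem truncated_profile {r s : ℝ} (hs : 0 ≤ s) {N : ℕ} {g : ℕ → ℝ}
    (hg0 : ∀ i ≤ N, 0 ≤ g i) (hg1 : ∀ i ≤ N, g i ≤ 1) (hgN : g N = 0)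
    (hconv : ∀ i, i + 1 < N → 0 ≤ r * g (i + 2) + s * g i - (r + s) * g (i + 1)) :
    ∃ φ : ℕ → ℝ, (∀ i, 0 ≤ φ i) ∧ φ 0 = 0 ∧ φ N = 0 ∧ (∀ i, φ i ≤ 1) ∧
      (∀ i, 1 ≤ i → i < N → -(if i = 1 then s else 0)
        ≤ r * φ (i + 1) + s * φ (i - 1) - (r + s) * φ i) ∧
      ∀ i, 1 ≤ i → i < N → φ i = g i := by
  refine ⟨fun i => if i = 0 ∨ N ≤ i then 0 else g i, fun i => ?_, by simp, by simp, fun i => ?_,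
    fun i h1 hi => ?_, fun i h1 hi => ?_⟩
  · dsimp only
    split_ifs with h
    · exact le_rfl
    · exact hg0 i (by omega)
  · dsimp only
    split_ifs with h
    · exact zero_le_one
    · exact hg1 i (by omega)
  · obtain ⟨j, rfl⟩ : ∃ j, i = j + 1 := ⟨i - 1, by omega⟩
    have hc := hconv j hi
    have e1 : (if j + 1 + 1 = 0 ∨ N ≤ j + 1 + 1 then 0 else g (j + 1 + 1)) = g (j + 2) := by
      by_cases h : N = j + 2
      · rw [if_pos (by omega), ← h, hgN]
      · rw [if_neg (by omega)]
    have e2 : (if j + 1 = 0 ∨ N ≤ j + 1 then 0 else g (j + 1)) = g (j + 1) := by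
      rw [if_neg (by omega)]
    dsimp only
    rw [e1, e2, Nat.add_sub_cancel]
    by_cases hj : j = 0
    · subst hj
      have := mul_le_mul_of_nonneg_left (hg1 0 (Nat.zero_le _)) hs
      simp only [zero_add, if_true, true_or] at hc ⊢
      linarith
    · rw [if_neg (by omega), if_neg (by omega)]
      linarith
  · dsimp only
    rw [if_neg (by omega)]

/-- Profiles for `tube_inequality` that approximate the probability that the walk with rates `r`
upwards and `s` downwards hits `0` before `N`.  Starting from `1`, it escapes to `N` with
probability `(r - s)⁺ / r` up to `o(1)`; starting from `N - 1`, it gets to `0` with probability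
`(s - r)⁺ / s` up to `o(1)`. -/
theorem exists_passage_profile {r s : ℝ} (hr : 0 ≤ r) (hs : 0 ≤ s) {ε : ℝ} (hε : 0 < ε) :
    ∀ᶠ N : ℕ in atTop, ∃ φ : ℕ → ℝ, (∀ i, 0 ≤ φ i) ∧ φ 0 = 0 ∧ φ N = 0 ∧ (∀ i, φ i ≤ 1) ∧
      (∀ i, 1 ≤ i → i < N → -(if i = 1 then s else 0)
        ≤ r * φ (i + 1) + s * φ (i - 1) - (r + s) * φ i) ∧
      r - max (r - s) 0 - ε ≤ r * φ 1 ∧ max (s - r) 0 - ε ≤ s * φ (N - 1) := by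
  rcases lt_trichotomy r s with hrs | hrs | hrs
  · have hs0 : 0 < s := hr.trans_lt hrs
    obtain ⟨ρ, hρ⟩ : ∃ ρ, ρ = r / s := ⟨_, rfl⟩
    have hρ0 : 0 ≤ ρ := hρ ▸ div_nonneg hr hs
    have hρ1 : ρ < 1 := by rw [hρ]; exact (div_lt_one hs0).2 hrs
    have hrρ : r = s * ρ := by rw [hρ]; field_simp
    have ht : Tendsto (fun N : ℕ => r * ρ ^ (N - 1)) atTop (𝓝 0) := by
      have := ((tendsto_pow_atTop_nhds_zero_of_lt_one hρ0 hρ1).comp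
        (tendsto_sub_atTop_nat 1)).const_mul r
      simpa using this
    filter_upwards [ht.eventually (gt_mem_nhds hε), eventually_ge_atTop 2] with N hN h2
    obtain ⟨φ, a1, a2, a3, a4, a5, a6⟩ := truncated_profile (r := r) hs (N := N)
      (g := fun i => 1 - ρ ^ (N - i)) (fun i _ => sub_nonneg.2 (pow_le_one₀ hρ0 hρ1.le))
      (fun i _ => sub_le_self _ (pow_nonneg hρ0 _)) (by simp) (fun i hi => by
        obtain ⟨k, hk⟩ : ∃ k, N = i + 2 + k := ⟨N - (i + 2), by omega⟩
        have e1 : N - (i + 2) = k := by omega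
        have e2 : N - (i + 1) = k + 1 := by omega
        have e3 : N - i = k + 2 := by omega
        rw [e1, e2, e3, hrρ]
        exact le_of_eq (by ring))
    refine ⟨φ, a1, a2, a3, a4, a5, ?_, ?_⟩
    · rw [a6 1 le_rfl (by omega), max_eq_right (by linarith)]
      linarith
    · have e : N - (N - 1) = 1 := by omega
      rw [a6 (N - 1) (by omega) (by omega), e, max_eq_left (by linarith), hrρ]
      linarith
  · subst hrs
    have ht : Tendsto (fun N : ℕ => r * (1 / (N : ℝ))) atTop (𝓝 0) := by
      simpa using tendsto_one_div_atTop_nhds_zero_nat.const_mul r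
    filter_upwards [ht.eventually (gt_mem_nhds hε), eventually_ge_atTop 2] with N hN h2
    have hN0 : (0 : ℝ) < N := by exact_mod_cast (by omega : 0 < N)
    obtain ⟨φ, a1, a2, a3, a4, a5, a6⟩ := truncated_profile (r := r) hs (N := N)
      (g := fun i => 1 - i / N)
      (fun i hi => sub_nonneg.2 ((div_le_one hN0).2 (by exact_mod_cast hi)))
      (fun i _ => sub_le_self _ (by positivity)) (by field_simp; simp) (fun i hi => by
        push_cast
        exact le_of_eq (by ring))
    refine ⟨φ, a1, a2, a3, a4, a5, ?_, ?_⟩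
    · rw [a6 1 le_rfl (by omega)]
      simp only [sub_self, max_self, Nat.cast_one]
      linarith
    · have := mul_nonneg hr (a1 (N - 1))
      simp only [sub_self, max_self]
      linarith
  · have hr0 : 0 < r := hs.trans_lt hrs
    obtain ⟨ρ, hρ⟩ : ∃ ρ, ρ = s / r := ⟨_, rfl⟩
    have hρ0 : 0 ≤ ρ := hρ ▸ div_nonneg hs hr
    have hρ1 : ρ < 1 := by rw [hρ]; exact (div_lt_one hr0).2 hrs
    have hsρ : s = r * ρ := by rw [hρ]; field_simp
    have ht : Tendsto (fun N : ℕ => r * ρ ^ N) atTop (𝓝 0) := by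
      simpa using (tendsto_pow_atTop_nhds_zero_of_lt_one hρ0 hρ1).const_mul r
    filter_upwards [ht.eventually (gt_mem_nhds hε), eventually_ge_atTop 2] with N hN h2
    obtain ⟨φ, a1, a2, a3, a4, a5, a6⟩ := truncated_profile (r := r) hs (N := N)
      (g := fun i => ρ ^ i - ρ ^ N)
      (fun i hi => sub_nonneg.2 (pow_le_pow_of_le_one hρ0 hρ1.le hi))
      (fun i _ => (sub_le_self _ (pow_nonneg hρ0 _)).trans (pow_le_one₀ hρ0 hρ1.le))
      (by simp) (fun i hi => by
        rw [hsρ]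
        exact le_of_eq (by ring))
    refine ⟨φ, a1, a2, a3, a4, a5, ?_, ?_⟩
    · rw [a6 1 le_rfl (by omega), max_eq_left (by linarith), pow_one, mul_sub, ← hsρ]
      linarith
    · have := mul_nonneg hs (a1 (N - 1))
      rw [max_eq_right (by linarith)]
      linarith

/-- The profile `i ↦ i` is turned into a bounded one at the price of a multiple of the harmonic
function `(s / r) ^ i - 1`, which beats it for large `i`. -/
theorem exists_excursion_profile {r s : ℝ} (hr : 0 ≤ r) (hrs : r < s) {ε : ℝ} (hε : 0 < ε) :
    ∃ (φ : ℕ → ℝ) (B : ℝ), (∀ i, 0 ≤ φ i) ∧ φ 0 = 0 ∧ (∀ᶠ N in atTop, φ N = 0) ∧ (∀ i, φ i ≤ B) ∧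
      (∀ i, 1 ≤ i → -(s - r) ≤ r * φ (i + 1) + s * φ (i - 1) - (r + s) * φ i) ∧
      r - ε ≤ r * φ 1 := by
  rcases hr.eq_or_lt with rfl | hr0
  · exact ⟨fun _ => 0, 0, by simp, rfl, by simp, by simp, fun i _ => by simpa using hrs.le,
      by linarith⟩
  obtain ⟨q, hq⟩ : ∃ q, q = s / r := ⟨_, rfl⟩
  have hq1 : 1 < q := by rw [hq]; exact (one_lt_div hr0).2 hrs
  have hsq : s = r * q := by rw [hq]; field_simp
  -- with this multiple of the harmonic function, `r * c * (s / r - 1) = ε` is lost at height one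
  obtain ⟨c, hc⟩ : ∃ c, c = ε / (s - r) := ⟨_, rfl⟩
  have hsr : 0 < s - r := sub_pos.2 hrs
  have hc0 : 0 < c := hc ▸ div_pos hε hsr
  have hcε : c * (s - r) = ε := by rw [hc]; field_simp
  obtain ⟨ψ, hψ⟩ : ∃ ψ : ℕ → ℝ, ∀ i : ℕ, ψ i = (i : ℝ) - c * (q ^ i - 1) :=
    ⟨fun i => (i : ℝ) - c * (q ^ i - 1), fun _ => rfl⟩
  have hev : ∀ᶠ N in atTop, max 0 (ψ N) = 0 := by
    have h1 : Tendsto (fun n : ℕ => (n : ℝ) / q ^ n) atTop (𝓝 0) := by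
      simpa using tendsto_pow_const_div_const_pow_of_one_lt 1 hq1
    filter_upwards [h1.eventually (gt_mem_nhds (show 0 < c / 2 by positivity)),
      (tendsto_pow_atTop_atTop_of_one_lt hq1).eventually_ge_atTop 2] with n hn h2
    rw [div_lt_iff₀ (by linarith)] at hn
    have := mul_le_mul_of_nonneg_left h2 hc0.le
    exact max_eq_left (by rw [hψ]; linarith)
  obtain ⟨n, hn⟩ := eventually_atTop.1 hev
  refine ⟨fun i => max 0 (ψ i), n, fun i => le_max_left _ _, by simp [hψ], hev, fun i => ?_,
    fun i hi => ?_, ?_⟩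
  · rcases le_total n i with h | h
    · dsimp only; rw [hn i h]; positivity
    · refine max_le (by positivity) ?_
      have h1 : (1 : ℝ) ≤ q ^ i := one_le_pow₀ hq1.le
      have h2 : (i : ℝ) ≤ n := by exact_mod_cast h
      have h3 := mul_nonneg hc0.le (sub_nonneg.2 h1)
      rw [hψ]
      linarith
  · obtain ⟨j, rfl⟩ : ∃ j, i = j + 1 := ⟨i - 1, by omega⟩
    dsimp only
    rw [Nat.add_sub_cancel]
    have hs0 : 0 ≤ s := hr.trans hrs.le
    rcases le_total 0 (ψ (j + 1)) with h | h
    · rw [max_eq_right h]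
      have h1 := mul_le_mul_of_nonneg_left (le_max_right 0 (ψ (j + 1 + 1))) hr
      have h2 := mul_le_mul_of_nonneg_left (le_max_right 0 (ψ j)) hs0
      have h3 : r * ψ (j + 1 + 1) + s * ψ j - (r + s) * ψ (j + 1) = -(s - r) := by
        simp only [hψ]
        push_cast
        rw [hsq]
        ring
      linarith
    · rw [max_eq_left h]
      have h1 := mul_nonneg hr (le_max_left 0 (ψ (j + 1 + 1)))
      have h2 := mul_nonneg hs0 (le_max_left 0 (ψ j))
      linarith
  · have h1 := mul_le_mul_of_nonneg_left (le_max_right 0 (ψ 1)) hr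
    refine le_trans (le_of_eq ?_) h1
    rw [hψ, ← hcε, hsq]
    push_cast
    ring

end Profiles

/-! ### Limits of the condensed masses are balanced for the asymmetric rates -/

section Limits

theorem le_of_forall_le_add_mul {A B C : ℝ} (h : ∀ ε > 0, A ≤ B + ε * C) : A ≤ B := by
  have h1 : Tendsto (fun ε : ℝ => B + ε * C) (𝓝[>] 0) (𝓝 B) := by
    have : Tendsto (fun ε : ℝ => B + ε * C) (𝓝 0) (𝓝 (B + 0 * C)) :=
      (tendsto_id.mul_const C).const_add B
    simpa using this.mono_left nhdsWithin_le_nhds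
  exact ge_of_tendsto h1 (eventually_nhdsWithin_of_forall fun ε hε => h ε hε)

variable {S : Type*} [Fintype S] [DecidableEq S]

theorem tendsto_spreadMass {r : S → S → ℝ} {d : ℕ → ℝ} (hcond : Condensation r d) :
    Tendsto (fun N => spreadMass N (inclusionMeasure r (d N) N)) atTop (𝓝 0) := by
  have h := hcond.const_sub 1
  rw [sub_self] at h
  refine h.congr' ?_
  filter_upwards [eventually_ne_atTop 0] with N hN
  unfold spreadMass condensedSet
  rw [Finset.sum_image fun a _ b _ h => condensed_injective hN h]

/-- At finite `N`, the masses of the condensed configurations almost satisfy the balance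
inequality at `x` for the rates `asymRate r`. -/
theorem eventually_asymRate_balance_le [Nonempty S] {r : S → S → ℝ} (hr : ∀ x y, 0 ≤ r x y)
    (hdiag : ∀ x, r x x = 0) {d : ℕ → ℝ} (hd : ∀ N, 1 ≤ N → 0 < d N) (x : S) {ε : ℝ} (hε : 0 < ε) :
    ∀ᶠ N in atTop,
      ∑ y, ((r x y - asymRate r x y - ε) * inclusionMeasure r (d N) N (condensed N x)
        + (asymRate r y x - ε) * inclusionMeasure r (d N) N (condensed N y))
      ≤ (∑ y, r x y) * inclusionMeasure r (d N) N (condensed N x)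
        + Fintype.card S * (∑ a, ∑ b, r a b) * spreadMass N (inclusionMeasure r (d N) N) := by
  have hprof := fun y => exists_passage_profile (hr x y) (hr y x) hε
  filter_upwards [eventually_all.2 hprof, eventually_ge_atTop 2] with N hN h2
  have hδ := hd N (by omega)
  have hμ := isInvariant_inclusionMeasure hr hδ N
  have hN0 : (0 : ℝ) < N := by exact_mod_cast (by omega : 0 < N)
  set μ := inclusionMeasure r (d N) N
  have hsp := spreadMass_nonneg (by omega) hμ.sum_eq_one hμ.nonneg
  have hR0 : 0 ≤ ∑ a, ∑ b, r a b :=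
    Finset.sum_nonneg fun a _ => Finset.sum_nonneg fun b _ => hr a b
  have hpos : 0 < d N * N := mul_pos hδ hN0
  have key : ∀ y, d N * N * ((r x y - asymRate r x y - ε) * μ (condensed N x)
        + (asymRate r y x - ε) * μ (condensed N y))
      ≤ ∑ η, μ η * (if η.1 x + η.1 y = N then
        (η.1 x : ℝ) * η.1 y * (if η.1 y = 1 then r y x else 0) else 0)
        + N * d N * (∑ a, ∑ b, r a b) * 1 * spreadMass N μ := by
    intro y
    by_cases hxy : x = y
    · subst hxy
      have h1 : asymRate r x x = 0 := by simp [asymRate]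
      have h3 := hμ.nonneg (condensed N x)
      simp only [hdiag, h1, ite_self, mul_zero, Finset.sum_const_zero, zero_sub, zero_add, sub_self]
      have h4 : 0 ≤ N * d N * (∑ a, ∑ b, r a b) * 1 * spreadMass N μ := by positivity
      have h5 : 0 ≤ d N * N * (ε * μ (condensed N x)) := by positivity
      linarith
    · obtain ⟨φ, a1, a2, a3, a4, a5, a6, a7⟩ := hN y
      refine le_trans (mul_le_mul_of_nonneg_left ?_ hpos.le)
        (tube_inequality hr hδ (by omega) hμ hxy (κ := fun i => if i = 1 then r y x else 0)
          a1 a2 a3 a4 a5)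
      exact add_le_add (mul_le_mul_of_nonneg_right a6 (hμ.nonneg _))
        (mul_le_mul_of_nonneg_right a7 (hμ.nonneg _))
  have hsum := Finset.sum_le_sum fun y (_ : y ∈ Finset.univ) => key y
  rw [← Finset.mul_sum] at hsum
  refine le_of_mul_le_mul_left (hsum.trans ?_) hpos
  have hbal := condensed_balance hr hdiag hδ h2 hμ x
  rw [Finset.sum_add_distrib, Finset.sum_const, Finset.card_univ, nsmul_eq_mul]
  linarith

/-- Limit points of the masses of the condensed configurations are balanced for the rates
`asymRate r`. -/
theorem balanced_asymRate_of_tendsto [Nonempty S] {r : S → S → ℝ} (hr : ∀ x y, 0 ≤ r x y)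
    (hdiag : ∀ x, r x x = 0) {d : ℕ → ℝ} (hd : ∀ N, 1 ≤ N → 0 < d N) (hcond : Condensation r d)
    {U : Filter ℕ} [U.NeBot] (hU : U ≤ atTop) {m : S → ℝ}
    (hm : ∀ x, Tendsto (fun N => inclusionMeasure r (d N) N (condensed N x)) U (𝓝 (m x))) :
    Balanced (asymRate r) m := by
  have hle : ∀ x ∈ Finset.univ, ∑ y, m y * asymRate r y x ≤ m x * ∑ y, asymRate r x y := by
    intro x _
    refine le_of_forall_le_add_mul (C := ∑ y, (m x + m y)) fun ε hε => ?_
    have h1 := (eventually_asymRate_balance_le hr hdiag hd x hε).filter_mono hU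
    have h2 : Tendsto (fun N => ∑ y,
        ((r x y - asymRate r x y - ε) * inclusionMeasure r (d N) N (condensed N x)
          + (asymRate r y x - ε) * inclusionMeasure r (d N) N (condensed N y))) U
        (𝓝 (∑ y, ((r x y - asymRate r x y - ε) * m x + (asymRate r y x - ε) * m y))) :=
      tendsto_finsetSum _ fun y _ => ((hm x).const_mul _).add ((hm y).const_mul _)
    have h3 := ((hm x).const_mul (∑ y, r x y)).add
      (((tendsto_spreadMass hcond).mono_left hU).const_mul
        (Fintype.card S * (∑ a, ∑ b, r a b)))
    have h4 := le_of_tendsto_of_tendsto h2 h3 h1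
    have e : ∑ y, ((r x y - asymRate r x y - ε) * m x + (asymRate r y x - ε) * m y)
        = (∑ y, r x y) * m x - m x * ∑ y, asymRate r x y + ∑ y, m y * asymRate r y x
          - ε * ∑ y, (m x + m y) := by
      simp only [Finset.mul_sum, Finset.sum_mul, ← Finset.sum_add_distrib,
        ← Finset.sum_sub_distrib]
      exact Finset.sum_congr rfl fun y _ => by ring
    rw [e, mul_zero, add_zero] at h4
    linarith
  -- the one-sided inequalities are equalities, as both sides have the same sum over `x`
  have hsum : ∑ x, ∑ y, m y * asymRate r y x = ∑ x, m x * ∑ y, asymRate r x y := by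
    rw [Finset.sum_comm]
    simp only [Finset.mul_sum]
  exact fun x => (Finset.sum_eq_sum_iff_of_le hle).1 hsum x (Finset.mem_univ x)

end Limits

/-! ### Invariant measures and transient states -/

section Support

variable {V : Type*} [Fintype V]

/-- Invariant measures do not charge transient states: there is no flow into the closed set of the
states reached from some `y`, so every path that enters it starts from a state of mass zero. -/
theorem Balanced.eq_zero_of_not_isRecurrent {q : V → V → ℝ} (hq : ∀ x y, 0 ≤ q x y) {v : V → ℝ}
    (hv : Balanced q v) (h0 : ∀ x, 0 ≤ v x) {x : V} (hx : ¬IsRecurrent q x) : v x = 0 := by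
  classical
  rw [isRecurrent_iff hq] at hx
  push Not at hx
  obtain ⟨y, hxy, hyx⟩ := hx
  -- the indicator of the set reached from `y` never decreases along jumps
  set F : V → ℝ := fun u => if Reaches q y u then 1 else 0 with hF
  have hst := (stationary_iff_balanced q v).2 hv F
  have hterm : ∀ a b, 0 ≤ q a b * (F b - F a) := by
    intro a b
    rcases (hq a b).eq_or_lt with h | h
    · simp [← h]
    · refine mul_nonneg h.le ?_
      by_cases ha : Reaches q y a
      · have hb : Reaches q y b := ha.tail h
        simp [hF, ha, hb]
      · simp only [hF, ha, if_false, sub_zero]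
        split_ifs <;> norm_num
  have hgen : ∀ a, 0 ≤ jumpGenerator q F a := fun a => Finset.sum_nonneg fun b _ => hterm a b
  have hzero : ∀ a b, ¬Reaches q y a → Reaches q y b → 0 < q a b → v a = 0 := by
    intro a b ha hb hab
    have h1 := (Finset.sum_eq_zero_iff_of_nonneg fun u _ => mul_nonneg (h0 u) (hgen u)).1 hst a
      (Finset.mem_univ a)
    refine (mul_eq_zero.1 h1).resolve_right (ne_of_gt ?_)
    refine Finset.sum_pos' (fun c _ => hterm a c) ⟨b, Finset.mem_univ b, ?_⟩
    simpa [hF, ha, hb] using hab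
  have hpath : v x = 0 ∨ Reaches q y x := by
    induction hxy using Relation.ReflTransGen.head_induction_on with
    | refl => exact Or.inr Relation.ReflTransGen.refl
    | @head a c hac _ ih =>
      by_cases ha : Reaches q y a
      · exact Or.inr ha
      left
      by_cases hc : Reaches q y c
      · exact hzero a c ha hc hac
      · exact hv.eq_zero_of_reaches hq h0 (Relation.ReflTransGen.single hac)
          ((ih hc).resolve_right hc)
  exact hpath.resolve_right hyx

theorem IsRecurrent.of_reaches {q : V → V → ℝ} (hq : ∀ x y, 0 ≤ q x y) {x y : V}
    (hx : IsRecurrent q x) (hxy : Reaches q x y) : IsRecurrent q y := by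
  rw [isRecurrent_iff hq] at hx ⊢
  exact fun z hyz => (hx z (hxy.trans hyz)).trans hxy

end Support

/-! ### The symmetric case: particle numbers as test functions -/

section SymmetricCase

variable {S : Type*} [Fintype S] [DecidableEq S]

/-- The number of particles at `z` follows a linear drift plus an antisymmetric pair interaction. -/
theorem inclusionGenerator_apply {r : S → S → ℝ} (hdiag : ∀ x, r x x = 0) (δ : ℝ) {N : ℕ} (z : S)
    (η : Config S N) :
    inclusionGenerator r δ N (fun ζ => (ζ.1 z : ℝ)) η
      = ∑ a, (δ * (r a z * η.1 a - r z a * η.1 z) + (r a z - r z a) * (η.1 a * η.1 z)) := by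
  have key : ∀ a b, (η.1 a : ℝ) * (δ + (η.1 b : ℝ)) * r a b *
        (((move η a b).1 z : ℝ) - (η.1 z : ℝ))
      = (if b = z then (η.1 a : ℝ) * (δ + (η.1 b : ℝ)) * r a b else 0)
        - (if a = z then (η.1 a : ℝ) * (δ + (η.1 b : ℝ)) * r a b else 0) := by
    intro a b
    by_cases hab : a = b
    · subst hab; simp [hdiag]
    by_cases ha : η.1 a = 0
    · simp [ha]
    have hm := move_apply η ha hab z
    by_cases h1 : z = a
    · subst h1
      have h2 : ((move η z b).1 z : ℝ) = η.1 z - 1 := by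
        rw [hm, if_pos rfl, Nat.cast_sub (by omega), Nat.cast_one]
      rw [h2, if_neg (Ne.symm hab), if_pos rfl]
      ring
    · by_cases h3 : z = b
      · subst h3
        have h2 : ((move η a z).1 z : ℝ) = η.1 z + 1 := by
          rw [hm, if_neg h1, if_pos rfl, Nat.cast_add, Nat.cast_one]
        rw [h2, if_pos rfl, if_neg hab]
        ring
      · rw [hm, if_neg h1, if_neg h3, if_neg (Ne.symm h3), if_neg (Ne.symm h1)]
        ring
  unfold inclusionGenerator
  simp only [key, Finset.sum_sub_distrib]
  rw [Finset.sum_comm]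
  simp only [Finset.sum_ite_irrel, Finset.sum_const_zero, Finset.sum_ite_eq', Finset.mem_univ,
    if_true]
  rw [← Finset.sum_sub_distrib]
  exact Finset.sum_congr rfl fun a _ => by ring

/-- The mean of a function on configurations under the invariant measure. -/
noncomputable def invariantMean (r : S → S → ℝ) (d : ℕ → ℝ) (N : ℕ) (F : Config S N → ℝ) : ℝ :=
  ∑ η, inclusionMeasure r (d N) N η * F η

theorem sum_invariantMean_eq_zero [Nonempty S] {r : S → S → ℝ} (hr : ∀ x y, 0 ≤ r x y)
    (hdiag : ∀ x, r x x = 0) {d : ℕ → ℝ} {N : ℕ} (hd : 0 < d N) (z : S) :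
    ∑ a, (d N * (r a z * invariantMean r d N (fun η => η.1 a)
        - r z a * invariantMean r d N (fun η => η.1 z))
      + (r a z - r z a) * invariantMean r d N (fun η => (η.1 a : ℝ) * η.1 z)) = 0 := by
  have h := (isInvariant_inclusionMeasure hr hd N).stationary fun ζ => (ζ.1 z : ℝ)
  simp only [inclusionGenerator_apply hdiag, Finset.mul_sum] at h
  rw [Finset.sum_comm] at h
  rw [← h]
  refine Finset.sum_congr rfl fun a _ => ?_
  simp only [invariantMean, Finset.mul_sum, ← Finset.sum_sub_distrib, ← Finset.sum_add_distrib]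
  exact Finset.sum_congr rfl fun η _ => by ring

theorem tendsto_mean_density [Nonempty S] {r : S → S → ℝ} (hr : ∀ x y, 0 ≤ r x y)
    {d : ℕ → ℝ} (hd : ∀ N, 1 ≤ N → 0 < d N) (hcond : Condensation r d)
    {U : Filter ℕ} (hU : U ≤ atTop) {m : S → ℝ}
    (hm : ∀ x, Tendsto (fun N => inclusionMeasure r (d N) N (condensed N x)) U (𝓝 (m x))) (a : S) :
    Tendsto (fun N : ℕ => invariantMean r d N (fun η => η.1 a) / N) U (𝓝 (m a)) := by
  have h1 : Tendsto (fun N => inclusionMeasure r (d N) N (condensed N a)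
      + spreadMass N (inclusionMeasure r (d N) N)) U (𝓝 (m a)) := by
    simpa using (hm a).add ((tendsto_spreadMass hcond).mono_left hU)
  have key : ∀ N : ℕ, 1 ≤ N → inclusionMeasure r (d N) N (condensed N a)
        ≤ invariantMean r d N (fun η => η.1 a) / N ∧
      invariantMean r d N (fun η => η.1 a) / N ≤ inclusionMeasure r (d N) N (condensed N a)
        + spreadMass N (inclusionMeasure r (d N) N) := by
    intro N hN
    have hμ := isInvariant_inclusionMeasure hr (hd N hN) N
    have hN0 : (0 : ℝ) < N := by exact_mod_cast hN
    have h2 : invariantMean r d N (fun η => η.1 a)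
        = inclusionMeasure r (d N) N (condensed N a) * N
          + ∑ η ∈ (condensedSet S N)ᶜ, inclusionMeasure r (d N) N η * η.1 a := by
      unfold invariantMean
      rw [sum_eq_condensed_add (by omega)]
      congr 1
      rw [Finset.sum_eq_single a (fun b _ hb => by simp [condensed, Ne.symm hb]) (by simp)]
      simp [condensed]
    rw [le_div_iff₀ hN0, div_le_iff₀ hN0, h2, spreadMass_eq (by omega) hμ.sum_eq_one, add_mul,
      Finset.sum_mul]
    refine ⟨le_add_of_nonneg_right (Finset.sum_nonneg fun η _ =>
      mul_nonneg (hμ.nonneg η) (Nat.cast_nonneg _)), add_le_add_right ?_ _⟩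
    refine Finset.sum_le_sum fun η _ => mul_le_mul_of_nonneg_left ?_ (hμ.nonneg η)
    exact_mod_cast apply_le η a
  refine tendsto_of_tendsto_of_tendsto_of_le_of_le' (hm a) h1 ?_ ?_
  · exact hU ((eventually_ge_atTop 1).mono fun N hN => (key N hN).1)
  · exact hU ((eventually_ge_atTop 1).mono fun N hN => (key N hN).2)

/-- Short excursions of particles from `z` to a less attractive site `a` already give the pair
interaction its full strength, which compensates the diffusive loss of particles from `z`
to `a`. -/
theorem eventually_pair_mean_ge [Nonempty S] {r : S → S → ℝ} (hr : ∀ x y, 0 ≤ r x y) {d : ℕ → ℝ}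
    (hd : ∀ N, 1 ≤ N → 0 < d N) {z a : S} (hza : z ≠ a)
    (hatt : 0 < r z a + r a z → r z a < r a z) {ε : ℝ} (hε : 0 < ε) :
    ∃ B : ℝ, ∀ᶠ N : ℕ in atTop,
      d N * N * ((r z a - ε) * inclusionMeasure r (d N) N (condensed N z))
        ≤ (r a z - r z a) * invariantMean r d N (fun η => (η.1 a : ℝ) * η.1 z)
          + d N * N * (B * spreadMass N (inclusionMeasure r (d N) N)) := by
  by_cases h0 : 0 < r z a + r a z
  · have hlt := hatt h0
    obtain ⟨φ, B, a1, a2, a3, a4, a5, a6⟩ := exists_excursion_profile (hr z a) hlt hε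
    refine ⟨(∑ a, ∑ b, r a b) * B, ?_⟩
    filter_upwards [a3, eventually_ge_atTop 1] with N hφN hN
    have hδ := hd N hN
    have hμ := isInvariant_inclusionMeasure hr hδ N
    have hpos : 0 ≤ d N * N := by positivity
    have h1 := tube_inequality hr hδ (by omega) hμ hza (κ := fun _ => r a z - r z a) a1 a2 hφN a4
      fun i hi _ => a5 i hi
    have h2 : ∑ η, inclusionMeasure r (d N) N η * (if η.1 z + η.1 a = N then
        (η.1 z : ℝ) * η.1 a * (r a z - r z a) else 0)
        ≤ (r a z - r z a) * invariantMean r d N (fun η => (η.1 a : ℝ) * η.1 z) := by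
      unfold invariantMean
      rw [Finset.mul_sum]
      refine Finset.sum_le_sum fun η _ => ?_
      have h3 : 0 ≤ (r a z - r z a) * (inclusionMeasure r (d N) N η * ((η.1 a : ℝ) * η.1 z)) :=
        mul_nonneg (sub_pos.2 hlt).le (mul_nonneg (hμ.nonneg η) (by positivity))
      split_ifs
      · exact le_of_eq (by ring)
      · simpa using h3
    have h4 : (r z a - ε) * inclusionMeasure r (d N) N (condensed N z)
        ≤ r z a * φ 1 * inclusionMeasure r (d N) N (condensed N z)
          + r a z * φ (N - 1) * inclusionMeasure r (d N) N (condensed N a) := by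
      have h5 := mul_le_mul_of_nonneg_right a6 (hμ.nonneg (condensed N z))
      have h6 := mul_nonneg (mul_nonneg (hr a z) (a1 (N - 1))) (hμ.nonneg (condensed N a))
      linarith
    have h7 := mul_le_mul_of_nonneg_left h4 hpos
    linarith
  · have h1 := hr z a
    have h2 := hr a z
    have e1 : r z a = 0 := by linarith
    have e2 : r a z = 0 := by linarith
    refine ⟨0, (eventually_ge_atTop 1).mono fun N hN => ?_⟩
    have hδ := hd N hN
    have hμ := (isInvariant_inclusionMeasure hr hδ N).nonneg (condensed N z)
    have : 0 ≤ d N * N * (ε * inclusionMeasure r (d N) N (condensed N z)) := by positivity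
    rw [e1, e2]
    linarith

/-- Limit points of the masses of the condensed configurations are balanced on an attracting set
with symmetric rates. -/
theorem balanced_restrictRate_of_tendsto [Nonempty S] {r : S → S → ℝ} (hr : ∀ x y, 0 ≤ r x y)
    (hdiag : ∀ x, r x x = 0) {d : ℕ → ℝ} (hd : ∀ N, 1 ≤ N → 0 < d N) (hcond : Condensation r d)
    {A : Finset S} (hsymm : ∀ x ∈ A, ∀ y ∈ A, r x y = r y x) (hatt : IsAttracting r A)
    {U : Filter ℕ} [U.NeBot] (hU : U ≤ atTop) {m : S → ℝ} (hm0 : ∀ x, 0 ≤ m x)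
    (hm : ∀ x, Tendsto (fun N => inclusionMeasure r (d N) N (condensed N x)) U (𝓝 (m x))) :
    Balanced (restrictRate r A) (fun x => m x) := by
  have hle : ∀ z ∈ A, ∑ a ∈ A, r a z * (m a - m z) ≤ 0 := by
    intro z hz
    -- `ε` is the loss from keeping excursions at bounded height; `N → ∞` is taken before `ε → 0`
    refine le_of_forall_le_add_mul (C := ∑ _a : S, m z) fun ε hε => ?_
    have hB : ∀ a, ∃ B : ℝ, a ∉ A → ∀ᶠ N : ℕ in atTop,
        d N * N * ((r z a - ε) * inclusionMeasure r (d N) N (condensed N z))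
          ≤ (r a z - r z a) * invariantMean r d N (fun η => (η.1 a : ℝ) * η.1 z)
            + d N * N * (B * spreadMass N (inclusionMeasure r (d N) N)) := by
      intro a
      by_cases ha : a ∈ A
      · exact ⟨0, fun h => absurd ha h⟩
      · obtain ⟨B, hB⟩ := eventually_pair_mean_ge hr hd (z := z) (a := a)
          (fun h => ha (h ▸ hz)) (hatt z hz a ha) hε
        exact ⟨B, fun _ => hB⟩
    choose B hB using hB
    have hev : ∀ᶠ N : ℕ in atTop, ∀ a, a ∉ A →
        d N * N * ((r z a - ε) * inclusionMeasure r (d N) N (condensed N z))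
          ≤ (r a z - r z a) * invariantMean r d N (fun η => (η.1 a : ℝ) * η.1 z)
            + d N * N * (B a * spreadMass N (inclusionMeasure r (d N) N)) :=
      eventually_all.2 fun a => eventually_imp_distrib_left.2 (hB a)
    set ρ : S → ℕ → ℝ := fun a N => invariantMean r d N (fun η => η.1 a) / N with hρ
    have hfin : ∀ᶠ N : ℕ in atTop, ∑ a, (r a z * ρ a N - r z a * ρ z N
        + if a ∈ A then 0 else (r z a - ε) * inclusionMeasure r (d N) N (condensed N z)
          - B a * spreadMass N (inclusionMeasure r (d N) N)) ≤ 0 := by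
      filter_upwards [hev, eventually_ge_atTop 1] with N hN h1
      have hδ := hd N h1
      have hN0 : (0 : ℝ) < N := by exact_mod_cast h1
      have hpos : 0 < d N * N := mul_pos hδ hN0
      have hst := sum_invariantMean_eq_zero hr hdiag hδ z
      refine le_of_mul_le_mul_left ?_ hpos
      rw [mul_zero, Finset.mul_sum]
      refine le_trans ?_ hst.le
      refine Finset.sum_le_sum fun a _ => ?_
      have e : d N * N * (r a z * ρ a N - r z a * ρ z N)
          = d N * (r a z * invariantMean r d N (fun η => η.1 a)
            - r z a * invariantMean r d N (fun η => η.1 z)) := by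
        simp only [hρ]
        field_simp
      rw [mul_add, e]
      refine add_le_add_right ?_ _
      split_ifs with ha
      · rw [hsymm a ha z hz]; simp
      · have := hN a ha
        linarith
    have hρm := fun a => tendsto_mean_density hr hd hcond hU hm a
    have hlim : Tendsto (fun N : ℕ => ∑ a, (r a z * ρ a N - r z a * ρ z N
        + if a ∈ A then 0 else (r z a - ε) * inclusionMeasure r (d N) N (condensed N z)
          - B a * spreadMass N (inclusionMeasure r (d N) N))) U
        (𝓝 (∑ a, (r a z * m a - r z a * m z
          + if a ∈ A then 0 else (r z a - ε) * m z - B a * 0))) := by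
      refine tendsto_finsetSum _ fun a _ => ?_
      refine (((hρm a).const_mul _).sub ((hρm z).const_mul _)).add ?_
      split_ifs
      · exact tendsto_const_nhds
      · exact ((hm z).const_mul _).sub (((tendsto_spreadMass hcond).mono_left hU).const_mul _)
    have h1 := le_of_tendsto hlim (hU hfin)
    have h2 : ∑ a, (if a ∈ A then r a z * (m a - m z) else 0) - ε * ∑ _a : S, m z
        ≤ ∑ a, (r a z * m a - r z a * m z
          + if a ∈ A then 0 else (r z a - ε) * m z - B a * 0) := by
      rw [Finset.mul_sum, ← Finset.sum_sub_distrib]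
      refine Finset.sum_le_sum fun a _ => ?_
      have h3 := mul_nonneg hε.le (hm0 z)
      have h4 := mul_nonneg (hr a z) (hm0 a)
      split_ifs with ha
      · rw [hsymm a ha z hz]
        linarith
      · linarith
    rw [Finset.sum_ite_mem, Finset.univ_inter] at h2
    linarith
  have hle' : ∀ z ∈ (Finset.univ : Finset A), ∑ a : A, m a * restrictRate r A a z
      ≤ m z * ∑ a : A, restrictRate r A z a := by
    intro z _
    have h1 := hle z z.2
    rw [← Finset.sum_coe_sort A] at h1
    rw [Finset.mul_sum, ← sub_nonpos, ← Finset.sum_sub_distrib]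
    refine le_trans (le_of_eq (Finset.sum_congr rfl fun a _ => ?_)) h1
    simp only [restrictRate]
    rw [hsymm z z.2 a a.2]
    ring
  have hsum : ∑ z : A, ∑ a : A, m a * restrictRate r A a z
      = ∑ z : A, m z * ∑ a : A, restrictRate r A z a := by
    rw [Finset.sum_comm]
    simp only [Finset.mul_sum]
  exact fun z => (Finset.sum_eq_sum_iff_of_le hle').1 hsum z (Finset.mem_univ z)

end SymmetricCase

/-! ### Convergence from the uniqueness of limit points -/

section Convergence

variable {S : Type*} [Fintype S]

theorem isInvariantMeasure_restrict {q : S → S → ℝ} {A : Finset S} {m : S → ℝ}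
    (hm0 : ∀ x, 0 ≤ m x) (hm1 : ∑ x, m x = 1) (hA : ∀ x ∉ A, m x = 0)
    (hb : Balanced (restrictRate q A) (fun x => m x)) :
    IsInvariantMeasure (jumpGenerator (restrictRate q A)) (fun x => m x) where
  nonneg x := hm0 x
  sum_eq_one := by
    rw [Finset.sum_coe_sort A m, ← hm1]
    exact Finset.sum_subset (Finset.subset_univ A) fun x _ hx => hA x hx
  stationary := (stationary_iff_balanced _ _).2 hb

/-- A sequence of vectors in the unit cube converges once all its limit points are invariant for
one and the same irreducible chain. -/
theorem tendsto_of_mapClusterPt_balanced {q : S → S → ℝ} (hq : ∀ x y, 0 ≤ q x y) {A : Finset S}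
    (hirr : IsIrreducibleChain (restrictRate q A)) {f : ℕ → S → ℝ}
    (hf : ∀ᶠ N in atTop, f N ∈ Set.Icc (0 : S → ℝ) 1)
    (hlim : ∀ m : S → ℝ, (∀ x, 0 ≤ m x) → MapClusterPt m atTop f →
      ∑ x, m x = 1 ∧ (∀ x ∉ A, m x = 0) ∧ Balanced (restrictRate q A) (fun x => m x)) :
    ∃ m : S → ℝ, IsInvariantMeasure (jumpGenerator (restrictRate q A)) (fun x => m x) ∧
      (∀ x ∈ A, 0 < m x) ∧ (∀ x ∉ A, m x = 0) ∧
      ∀ x, Tendsto (fun N => f N x) atTop (𝓝 (m x)) := by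
  have hcomp : IsCompact (Set.Icc (0 : S → ℝ) 1) := isCompact_Icc
  obtain ⟨m, hm, hmc⟩ := hcomp.exists_mapClusterPt (f := atTop) (u := f) (le_principal_iff.2 hf)
  obtain ⟨hm1, hmA, hmb⟩ := hlim m hm.1 hmc
  have hqA : ∀ x y, 0 ≤ restrictRate q A x y := fun x y => hq x y
  have hinv := isInvariantMeasure_restrict hm.1 hm1 hmA hmb
  refine ⟨m, hinv, fun x hx => lt_of_le_of_ne (hm.1 x) fun h => ?_, hmA, ?_⟩
  · have hz : ∀ y : A, m y = 0 := fun y =>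
      hmb.eq_zero_of_reaches hqA (fun z => hm.1 z) (hirr y ⟨x, hx⟩) h.symm
    have := hinv.sum_eq_one
    rw [Finset.sum_eq_zero fun y _ => hz y] at this
    exact zero_ne_one this
  · have ht : Tendsto f atTop (𝓝 m) := by
      refine hcomp.tendsto_nhds_of_unique_mapClusterPt hf fun m' hm' hmc' => ?_
      obtain ⟨h1, hA', hb'⟩ := hlim m' hm'.1 hmc'
      have heq := isInvariant_unique hqA hirr (isInvariantMeasure_restrict hm'.1 h1 hA' hb') hinv
      funext x
      by_cases hx : x ∈ A
      · exact congrFun heq ⟨x, hx⟩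
      · rw [hA' x hx, hmA x hx]
    exact fun x => (tendsto_pi_nhds.1 ht) x

end Convergence

/-! ### The condensing set and the limit of the masses -/

section Condensate

theorem asymRate_nonneg {S : Type*} (r : S → S → ℝ) (x y : S) : 0 ≤ asymRate r x y :=
  le_max_right _ _

theorem mem_recurrentSet {S : Type*} [Fintype S] {r : S → S → ℝ} {x : S} :
    x ∈ recurrentSet r ↔ IsRecurrent (asymRate r) x := by
  simp [recurrentSet]

/-- No jump of positive rate leaves the set of recurrent states. -/
theorem balanced_restrictRate_recurrentSet {S : Type*} [Fintype S] {r : S → S → ℝ} {m : S → ℝ}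
    (hb : Balanced (asymRate r) m) (hm : ∀ x ∉ recurrentSet r, m x = 0) :
    Balanced (restrictRate (asymRate r) (recurrentSet r)) (fun x => m x) := by
  intro y
  have hout : ∀ x ∉ recurrentSet r, asymRate r y x = 0 := by
    intro x hx
    by_contra h
    have h1 := lt_of_le_of_ne (asymRate_nonneg r y x) (Ne.symm h)
    exact hx (mem_recurrentSet.2 ((mem_recurrentSet.1 y.2).of_reaches (asymRate_nonneg r)
      (Relation.ReflTransGen.single h1)))
  have h1 := hb y
  rw [← Finset.sum_subset (Finset.subset_univ (recurrentSet r))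
      fun x _ hx => by rw [hm x hx, zero_mul],
    ← Finset.sum_subset (Finset.subset_univ (recurrentSet r)) fun x _ hx => hout x hx] at h1
  simp only [restrictRate]
  rw [Finset.sum_coe_sort (recurrentSet r) fun x => m x * asymRate r x y,
    Finset.sum_coe_sort (recurrentSet r) fun x => asymRate r y x]
  exact h1

variable {S : Type*} [Fintype S] [DecidableEq S] [Nonempty S]

/-- If the limit points of the masses of the condensed configurations are balanced for an
irreducible chain on the recurrent set, then the recurrent set is the condensing set, and the
masses converge to the invariant measure of that chain. -/
theorem condensate_limit {r : S → S → ℝ} (hr : ∀ x y, 0 ≤ r x y)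
    (hdiag : ∀ x, r x x = 0) {d : ℕ → ℝ} (hd : ∀ N, 1 ≤ N → 0 < d N) (hcond : Condensation r d)
    {q : S → S → ℝ} (hq : ∀ x y, 0 ≤ q x y)
    (hirr : IsIrreducibleChain (restrictRate q (recurrentSet r)))
    (hbal : ∀ (m : S → ℝ) (U : Filter ℕ) [U.NeBot], U ≤ atTop → (∀ x, 0 ≤ m x) →
      (∀ x ∉ recurrentSet r, m x = 0) → Balanced (asymRate r) m →
      (∀ x, Tendsto (fun N => inclusionMeasure r (d N) N (condensed N x)) U (𝓝 (m x))) →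
      Balanced (restrictRate q (recurrentSet r)) (fun x => m x)) :
    IsIrreducibleChain (restrictRate q (condensingSet r d)) ∧
      ∃ ν : condensingSet r d → ℝ,
        IsInvariantMeasure (jumpGenerator (restrictRate q (condensingSet r d))) ν ∧
        (∀ ν' : condensingSet r d → ℝ,
          IsInvariantMeasure (jumpGenerator (restrictRate q (condensingSet r d))) ν' → ν' = ν) ∧
        ∀ x : condensingSet r d,
          Tendsto (fun N => inclusionMeasure r (d N) N (condensed N (x : S))) atTop (𝓝 (ν x)) := by
  have hf : ∀ᶠ N in atTop, (fun x => inclusionMeasure r (d N) N (condensed N x))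
      ∈ Set.Icc (0 : S → ℝ) 1 := by
    filter_upwards [eventually_ge_atTop 1] with N hN
    have hμ := isInvariant_inclusionMeasure hr (hd N hN) N
    refine ⟨fun x => hμ.nonneg _, fun x => ?_⟩
    rw [Pi.one_apply, ← hμ.sum_eq_one]
    exact Finset.single_le_sum (fun η _ => hμ.nonneg η) (Finset.mem_univ _)
  obtain ⟨m, hinv, hpos, hzero, hm⟩ := tendsto_of_mapClusterPt_balanced hq hirr hf
    fun m hm0 hmc => by
      obtain ⟨U, hU, hUm⟩ := mapClusterPt_iff_ultrafilter.1 hmc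
      have hUm' := fun x => (tendsto_pi_nhds.1 hUm) x
      have hb := balanced_asymRate_of_tendsto hr hdiag hd hcond hU hUm'
      have hA : ∀ x ∉ recurrentSet r, m x = 0 := fun x hx =>
        hb.eq_zero_of_not_isRecurrent (asymRate_nonneg r) hm0 fun h => hx (mem_recurrentSet.2 h)
      refine ⟨?_, hA, hbal m U hU hm0 hA hb hUm'⟩
      have h1 := ((tendsto_spreadMass hcond).mono_left hU).const_sub 1
      simp only [spreadMass, sub_sub_cancel, sub_zero] at h1
      exact tendsto_nhds_unique (tendsto_finsetSum _ fun x _ => hUm' x) h1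
  have hset : condensingSet r d = recurrentSet r := by
    ext x
    simp only [condensingSet, Finset.mem_filter, Finset.mem_univ, true_and, (hm x).limsup_eq]
    refine ⟨fun h => ?_, hpos x⟩
    by_contra hx
    exact h.ne' (hzero x hx)
  rw [hset]
  exact ⟨hirr, fun x => m x, hinv,
    fun ν' hν' => isInvariant_unique (q := restrictRate q (recurrentSet r)) (fun x y => hq x y) hirr
      hν' hinv, fun x => hm x⟩

end Condensate

end InclusionProcess


theorem theorem3p10 {S : Type*} [Fintype S] [DecidableEq S] [Nonempty S]
    -- the underlying random walk
    (r : S → S → ℝ) (hr_nonneg : ∀ x y, 0 ≤ r x y) (hr_diag : ∀ x, r x x = 0)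
    (hr_irr : IsIrreducibleChain r)
    -- the diffusion parameters
    (d : ℕ → ℝ) (hd_pos : ∀ N, 1 ≤ N → 0 < d N) (hd_lim : Tendsto d atTop (𝓝 0))
    (hd_log : Tendsto (fun N : ℕ => d N * Real.log N) atTop (𝓝 0))
    (hcond : Condensation r d) :
    -- the asymmetric case
    (IsIrreducibleChain (restrictRate (asymRate r) (recurrentSet r)) →
      IsIrreducibleChain (restrictRate (asymRate r) (condensingSet r d)) ∧
      ∃ ν : condensingSet r d → ℝ,
        IsInvariantMeasure (jumpGenerator (restrictRate (asymRate r) (condensingSet r d))) ν ∧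
        (∀ ν' : condensingSet r d → ℝ,
          IsInvariantMeasure (jumpGenerator (restrictRate (asymRate r) (condensingSet r d))) ν' →
            ν' = ν) ∧
        ∀ x : condensingSet r d,
          Tendsto (fun N => inclusionMeasure r (d N) N (condensed N (x : S))) atTop (𝓝 (ν x))) ∧
    -- the symmetric case
    ((∀ x ∈ recurrentSet r, ∀ y ∈ recurrentSet r, r x y = r y x) →
      IsIrreducibleChain (restrictRate r (recurrentSet r)) →
      IsAttracting r (recurrentSet r) →
      IsIrreducibleChain (restrictRate r (condensingSet r d)) ∧
      ∃ ν : condensingSet r d → ℝ,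
        IsInvariantMeasure (jumpGenerator (restrictRate r (condensingSet r d))) ν ∧
        (∀ ν' : condensingSet r d → ℝ,
          IsInvariantMeasure (jumpGenerator (restrictRate r (condensingSet r d))) ν' → ν' = ν) ∧
        ∀ x : condensingSet r d,
          Tendsto (fun N => inclusionMeasure r (d N) N (condensed N (x : S))) atTop
            (𝓝 (ν x))) := by
  refine ⟨fun hirr => ?_, fun hsymm hirr hatt => ?_⟩
  · exact condensate_limit hr_nonneg hr_diag hd_pos hcond (asymRate_nonneg r) hirr
      fun m U _ _ _ hA hb _ => balanced_restrictRate_recurrentSet hb hA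
  · exact condensate_limit hr_nonneg hr_diag hd_pos hcond hr_nonneg hirr
      fun m U _ hU hm0 _ _ hm =>
        balanced_restrictRate_of_tendsto hr_nonneg hr_diag hd_pos hcond hsymm hatt hU hm0 hm
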